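/- Let $s\ge 2$ and let $X$ be a smooth manifold of dimension $2(s+1)$ with a (pointwise, nondegenerate) $s$-Kähler structure of rank two: a smooth Riemannian metric and smooth two-forms $\omega_{jk}$, $j,k\in\{0,\dots,s\}$, such that every cotangent space $T_p^*X$ has an *adapted coframe*, i.e. an orthonormal basis $v_{ij}$ ($i=1,2$, $j=0,\dots,s$) with $\omega_{jk}=v_{1j}\wedge v_{1k}+v_{2j}\wedge v_{2k}$ for all $j,k$. ($s$-Kähler and almost $s$-Kähler manifolds of rank two satisfy in addition integrability conditions, which are not needed.) Fix $p\in X$ and an adapted coframe at $p$. On $\bigwedge^*T_p^*X$ let $L_{jk}$ ($j\ne k$) be the wedge product with $\omega_{jk}$, let $V_j$ be the wedge product with $v_{1j}\wedge v_{2j}$, let $\Lambda_{jk}=L_{jk}^*$ and $A_j=V_j^*$ be the adjoints for the induced metric, and let $J_p$ be the derivation with $J_pv_{1j}=v_{2j}$, $J_pv_{2j}=-v_{1j}$. Let $\mathcal L^s_{\mathbb R,p}$ be the real Lie algebra of operators generated by all $L_{jk},V_j,\Lambda_{jk},A_j$, and let $\mathcal L^s_{\mathbb C,p}=\mathcal L^s_{\mathbb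 R,p}\otimes\mathbb C$, acting on $\bigwedge^*T_p^*X\otimes\mathbb C$; this is the fibre at $p$ of the bundle $\mathcal L^s_{\mathbb C}$. Let $\mathcal C_p$ be the Clifford algebra of $T_pX\oplus T_p^*X$ with relation $(x+\alpha)^2=\alpha(x)$, represented on $\bigwedge^*T_p^*X$ by contraction with vectors $x$ and wedge product with covectors $\alpha$. Its quadratic part $\mathcal C_p^2$ is the span of the commutators $[a,b]$, $a,b\in T_pX\oplus T_p^*X$, and the (complex) quadratic invariants are the elements of $\mathcal C^2_p\otimes\mathbb C$ which, as operators on forms, commute with $J_p$. Then: (a) $\mathcal L^s_{\mathbb C,p}$ is isomorphic, as a complex Lie algebra, to $\mathbf{sl}(2s+2,\mathbb C)$. (b) The line spanned by $J_p$ meets (the image in $\mathrm{End}(\bigwedge^*T_p^*X\otimes\mathbb C)$ of) $\mathcal L^s_{\mathbb C,p}$ only in $0$, and the representation of the Clifford algebra maps the space of quadratic invariants bijectively onto $\mathcal L^s_{\mathbb C,p}\oplus\langle J_p\rangle$. (c) The space $\mathcal I_{-s}$ of complex forms of $J$-weight $-s$, i.e. on which $J_p$ acts as $-\imath s$, has dimension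 $2s+2$; it is preserved by $\mathcal L^s_{\mathbb C,p}$, and the resulting representation of $\mathcal L^s_{\mathbb C,p}$ on $\mathcal I_{-s}$ is faithful. -/

import Mathlib

open scoped TensorProduct Manifold

attribute [local instance 100] LieRing.ofAssociativeRing

noncomputable section

namespace SKahler

/-! ### Exterior algebra of the dual of a real vector space `V` (the tangent space at a point) -/

section Linear

variable {V : Type*} [AddCommGroup V] [Module ℝ V]

/-- The exterior algebra `⋀^* V^*`. -/
abbrev Forms (V : Type*) [AddCommGroup V] [Module ℝ V] : Type _ :=
  ExteriorAlgebra ℝ (Module.Dual ℝ V)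

/-- The complexified exterior algebra `⋀^*_ℂ V^*`. -/
abbrev FormsC (V : Type*) [AddCommGroup V] [Module ℝ V] : Type _ :=
  ℂ ⊗[ℝ] Forms V

/-- The wedge operator `φ ↦ η ∧ φ`. -/
def wedge (η : Forms V) : Module.End ℝ (Forms V) :=
  LinearMap.mulLeft ℝ η

/-- The contraction (interior product) on `⋀^* W` with an element `d` of `W^*`: the antiderivation
of degree `-1` which is `d` in degree one. (In Mathlib the exterior algebra is, by definition, the
Clifford algebra of the zero form.) -/
def interior {W : Type*} [AddCommGroup W] [Module ℝ W] (d : Module.Dual ℝ W) :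
    Module.End ℝ (ExteriorAlgebra ℝ W) :=
  CliffordAlgebra.contractLeft (Q := (0 : QuadraticForm ℝ W)) d

theorem interior_one {W : Type*} [AddCommGroup W] [Module ℝ W] (d : Module.Dual ℝ W) :
    interior d (1 : ExteriorAlgebra ℝ W) = 0 :=
  CliffordAlgebra.contractLeft_one (Q := (0 : QuadraticForm ℝ W)) d

theorem interior_ι_mul {W : Type*} [AddCommGroup W] [Module ℝ W] (d : Module.Dual ℝ W) (a : W)
    (x : ExteriorAlgebra ℝ W) :
    interior d (ExteriorAlgebra.ι ℝ a * x) = d a • x - ExteriorAlgebra.ι ℝ a * interior d x :=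
  CliffordAlgebra.contractLeft_ι_mul (Q := (0 : QuadraticForm ℝ W)) d a x

theorem interior_interior {W : Type*} [AddCommGroup W] [Module ℝ W] (d : Module.Dual ℝ W)
    (x : ExteriorAlgebra ℝ W) : interior d (interior d x) = 0 :=
  CliffordAlgebra.contractLeft_contractLeft (Q := (0 : QuadraticForm ℝ W)) d x

/-- The element of `⋀² V^* ⊆ ⋀^* V^*` which corresponds to an alternating bilinear form on `V`,
with the convention `(a ∧ b)(x, y) = a(x) b(y) - a(y) b(x)`: the image of
`ω ∈ Hom(V, V^*) = V^* ⊗ V^*` under `a ⊗ b ↦ ½ a ∧ b`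
(see `twoFormElement_eq`). -/
def twoFormElement [FiniteDimensional ℝ V] (ω : V →ₗ[ℝ] V →ₗ[ℝ] ℝ) : Forms V :=
  (1 / 2 : ℝ) •
    TensorProduct.lift
      ((LinearMap.mul ℝ (Forms V)).compl₁₂ (ExteriorAlgebra.ι ℝ) (ExteriorAlgebra.ι ℝ))
      ((dualTensorHomEquiv (R := ℝ) (M := V) (N := Module.Dual ℝ V)).symm ω)

/-- The form `(x, y) ↦ a(x) b(y) - a(y) b(x)` corresponds to `a ∧ b`. -/
theorem twoFormElement_eq [FiniteDimensional ℝ V] (ω : V →ₗ[ℝ] V →ₗ[ℝ] ℝ) {ι : Type*} [Fintype ι]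
    (a b : ι → Module.Dual ℝ V) (h : ∀ x y, ω x y = ∑ i, (a i x * b i y - a i y * b i x)) :
    twoFormElement ω = ∑ i, ExteriorAlgebra.ι ℝ (a i) * ExteriorAlgebra.ι ℝ (b i) := by
  have h1 : (dualTensorHomEquiv (R := ℝ) (M := V) (N := Module.Dual ℝ V)).symm ω =
      ∑ i, (a i ⊗ₜ[ℝ] b i - b i ⊗ₜ[ℝ] a i) := by
    rw [LinearEquiv.symm_apply_eq]
    ext x y
    simp [h, dualTensorHom_apply, mul_comm]
  have h2 (i : ι) : ExteriorAlgebra.ι ℝ (b i) * ExteriorAlgebra.ι ℝ (a i) =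
      -(ExteriorAlgebra.ι ℝ (a i) * ExteriorAlgebra.ι ℝ (b i)) :=
    eq_neg_of_add_eq_zero_left (ExteriorAlgebra.ι_add_mul_swap _ _)
  rw [twoFormElement, h1, map_sum, Finset.smul_sum]
  refine Finset.sum_congr rfl fun i _ => ?_
  simp only [map_sub, TensorProduct.lift.tmul, LinearMap.compl₁₂_apply, LinearMap.mul_apply', h2]
  rw [sub_neg_eq_add, ← two_smul ℝ, smul_smul]
  norm_num

/-! ### The metric induced on forms -/

/-- The algebra homomorphism `⋀^* W → End(⋀^* W)ᵒᵖ` which sends `w ∈ W` to the contraction with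
`G(w, ·)`. Thus `w₁ ∧ ⋯ ∧ wₖ` goes to `i(wₖ) ∘ ⋯ ∘ i(w₁)`. -/
def contractHom {W : Type*} [AddCommGroup W] [Module ℝ W] (G : LinearMap.BilinForm ℝ W) :
    ExteriorAlgebra ℝ W →ₐ[ℝ] (Module.End ℝ (ExteriorAlgebra ℝ W))ᵐᵒᵖ :=
  ExteriorAlgebra.lift ℝ
    ⟨(MulOpposite.opLinearEquiv ℝ).toLinearMap ∘ₗ
        (CliffordAlgebra.contractLeft (Q := (0 : QuadraticForm ℝ W))) ∘ₗ G, fun w => by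
      apply MulOpposite.unop_injective
      exact LinearMap.ext fun x => interior_interior (G w) x⟩

/-- The bilinear form induced on `⋀^* W` by a bilinear form `G` on `W`:
`⟨x, y⟩` is the degree zero component of `contractHom G x` applied to `y`. On decomposable elements
it is the usual determinant, and elements of different degree are orthogonal, see
`extMetric_ιMulti` and `extMetric_ιMulti_of_ne`. -/
def extMetric {W : Type*} [AddCommGroup W] [Module ℝ W] (G : LinearMap.BilinForm ℝ W) :
    LinearMap.BilinForm ℝ (ExteriorAlgebra ℝ W) :=
  LinearMap.mk₂ ℝ
    (fun x y => ExteriorAlgebra.algebraMapInv ((contractHom G x).unop y))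
    (by intros; simp) (by intros; simp) (by intros; simp) (by intros; simp)

theorem extMetric_ι_mul {W : Type*} [AddCommGroup W] [Module ℝ W] (G : LinearMap.BilinForm ℝ W)
    (w : W) (x y : ExteriorAlgebra ℝ W) :
    extMetric G (ExteriorAlgebra.ι ℝ w * x) y = extMetric G x (interior (G w) y) := by
  simp [extMetric, contractHom, interior]

theorem extMetric_one {W : Type*} [AddCommGroup W] [Module ℝ W] (G : LinearMap.BilinForm ℝ W)
    (y : ExteriorAlgebra ℝ W) : extMetric G 1 y = ExteriorAlgebra.algebraMapInv y := by
  simp [extMetric]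

theorem interior_ιMulti {W : Type*} [AddCommGroup W] [Module ℝ W] (d : Module.Dual ℝ W) {n : ℕ}
    (u : Fin (n + 1) → W) :
    interior d (ExteriorAlgebra.ιMulti ℝ (n + 1) u) =
      ∑ j : Fin (n + 1), ((-1) ^ (j : ℕ) * d (u j)) •
        ExteriorAlgebra.ιMulti ℝ n (u ∘ j.succAbove) := by
  induction n with
  | zero =>
    rw [ExteriorAlgebra.ιMulti_succ_apply, interior_ι_mul]
    simp [interior_one]
  | succ n ih =>
    rw [ExteriorAlgebra.ιMulti_succ_apply, interior_ι_mul, Matrix.vecTail, ih, Finset.mul_sum,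
      sub_eq_add_neg, ← Finset.sum_neg_distrib, Fin.sum_univ_succ (n := n + 1)]
    congr 1
    · simp [Function.comp_def]
    · refine Finset.sum_congr rfl fun j _ => ?_
      have h : (u ∘ j.succ.succAbove) = Matrix.vecCons (u 0) ((u ∘ Fin.succ) ∘ j.succAbove) := by
        ext i
        refine Fin.cases ?_ (fun i => ?_) i <;> simp
      rw [h, ExteriorAlgebra.ιMulti_succ_apply]
      simp [pow_succ, Matrix.vecTail, Function.comp_def]

/-- `⟨a₁ ∧ ⋯ ∧ aₙ, b₁ ∧ ⋯ ∧ bₙ⟩ = det (⟨aᵢ, bⱼ⟩)`. -/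
theorem extMetric_ιMulti {W : Type*} [AddCommGroup W] [Module ℝ W] (G : LinearMap.BilinForm ℝ W)
    {n : ℕ} (a b : Fin n → W) :
    extMetric G (ExteriorAlgebra.ιMulti ℝ n a) (ExteriorAlgebra.ιMulti ℝ n b) =
      (Matrix.of fun i j => G (a i) (b j)).det := by
  induction n with
  | zero => simp [extMetric_one]
  | succ n ih =>
    rw [ExteriorAlgebra.ιMulti_succ_apply, extMetric_ι_mul, interior_ιMulti, map_sum,
      Matrix.det_succ_row_zero]
    refine Finset.sum_congr rfl fun j _ => ?_
    rw [map_smul, ih]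
    rfl

/-- Forms of different degrees are orthogonal. -/
theorem extMetric_ιMulti_of_ne {W : Type*} [AddCommGroup W] [Module ℝ W]
    (G : LinearMap.BilinForm ℝ W) {m n : ℕ} (h : m ≠ n) (a : Fin m → W) (b : Fin n → W) :
    extMetric G (ExteriorAlgebra.ιMulti ℝ m a) (ExteriorAlgebra.ιMulti ℝ n b) = 0 := by
  induction m generalizing n with
  | zero =>
    obtain ⟨n, rfl⟩ := Nat.exists_eq_succ_of_ne_zero (Ne.symm h)
    simp [extMetric_one, ExteriorAlgebra.ιMulti_succ_apply, ExteriorAlgebra.algebraMapInv]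
  | succ m ih =>
    rw [ExteriorAlgebra.ιMulti_succ_apply, extMetric_ι_mul]
    cases n with
    | zero => simp [interior_one]
    | succ n =>
      rw [interior_ιMulti, map_sum]
      refine Finset.sum_eq_zero fun j _ => ?_
      rw [map_smul, ih (fun e => h (by rw [e])), smul_zero]

/-- The metric that a nondegenerate form `g` on `V` induces on `V^*`: the transport of `g` by the
isomorphism `x ↦ g(x, ·)`. -/
def cometric [FiniteDimensional ℝ V] (g : LinearMap.BilinForm ℝ V) (hg : g.Nondegenerate) :
    LinearMap.BilinForm ℝ (Module.Dual ℝ V) :=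
  LinearMap.BilinForm.congr (g.toDual hg) g

/-- `B` is the adjoint of the operator `A` on `⋀^* V^*`, for the metric induced by the form `G` on
`V^*`. -/
def IsAdjoint (G : LinearMap.BilinForm ℝ (Module.Dual ℝ V)) (A B : Module.End ℝ (Forms V)) : Prop :=
  ∀ φ ψ, extMetric G (A φ) ψ = extMetric G φ (B ψ)

/-! ### Operators attached to a coframe `v i j`, with `i ∈ {0, 1}` and `j ∈ {0, …, s}` -/

variable {s : ℕ}

/-- A basis of the cotangent space `V^*` indexed by the pairs `(i, j)`. -/
abbrev Coframe (s : ℕ) (V : Type*) [AddCommGroup V] [Module ℝ V] : Type _ :=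
  Module.Basis (Fin 2 × Fin (s + 1)) ℝ (Module.Dual ℝ V)

/-- The wedge operator `E_{ij}` with `v_{ij}`. -/
def opE (v : Coframe s V) (i : Fin 2) (j : Fin (s + 1)) : Module.End ℝ (Forms V) :=
  wedge (ExteriorAlgebra.ι ℝ (v (i, j)))

/-- The contraction operator `I_{ij}` with the vector `∂/∂v_{ij}` of the frame dual to `v`. -/
def opI (v : Coframe s V) (i : Fin 2) (j : Fin (s + 1)) : Module.End ℝ (Forms V) :=
  interior (v.coord (i, j))

/-- The operator `J` on forms determined by the coframe: the derivation of `⋀^* V^*` with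
`J v_{1j} = v_{2j}` and `J v_{2j} = -v_{1j}`, see `opJ_left`, `opJ_right`, `opJ_mul`. -/
def opJ (v : Coframe s V) : Module.End ℝ (Forms V) :=
  ∑ j, (opE v 1 j * opI v 0 j - opE v 0 j * opI v 1 j)

/-- The wedge operator `V_j` with the volume form `v_{1j} ∧ v_{2j}`. -/
def opV (v : Coframe s V) (j : Fin (s + 1)) : Module.End ℝ (Forms V) :=
  opE v 0 j * opE v 1 j

theorem opJ_one (v : Coframe s V) : opJ v 1 = 0 := by
  simp [opJ, opI, interior_one]

theorem opJ_ι (v : Coframe s V) (a : Module.Dual ℝ V) :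
    opJ v (ExteriorAlgebra.ι ℝ a) = ExteriorAlgebra.ι ℝ
      (∑ j, (v.coord (0, j) a • v (1, j) - v.coord (1, j) a • v (0, j))) := by
  have h (d : Module.Dual ℝ (Module.Dual ℝ V)) :
      interior d (ExteriorAlgebra.ι ℝ a) = algebraMap ℝ _ (d a) := by
    have := interior_ι_mul d a 1
    rw [mul_one, interior_one, mul_zero, sub_zero] at this
    rw [this, Algebra.algebraMap_eq_smul_one]
  simp only [opJ, LinearMap.sum_apply, LinearMap.sub_apply, Module.End.mul_apply, opE, opI, wedge,
    h, LinearMap.mulLeft_apply, ← Algebra.commutes, ← Algebra.smul_def, map_sum, map_sub, map_smul]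

theorem opJ_left (v : Coframe s V) (j : Fin (s + 1)) :
    opJ v (ExteriorAlgebra.ι ℝ (v (0, j))) = ExteriorAlgebra.ι ℝ (v (1, j)) := by
  rw [opJ_ι]
  congr 1
  simp [Finsupp.single_apply, Finset.sum_ite_eq]

theorem opJ_right (v : Coframe s V) (j : Fin (s + 1)) :
    opJ v (ExteriorAlgebra.ι ℝ (v (1, j))) = -ExteriorAlgebra.ι ℝ (v (0, j)) := by
  rw [opJ_ι, ← map_neg]
  congr 1
  simp [Finsupp.single_apply, Finset.sum_ite_eq]

theorem opJ_ι_mul (v : Coframe s V) (a : Module.Dual ℝ V) (x : Forms V) :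
    opJ v (ExteriorAlgebra.ι ℝ a * x) =
      opJ v (ExteriorAlgebra.ι ℝ a) * x + ExteriorAlgebra.ι ℝ a * opJ v x := by
  have hs (b : Module.Dual ℝ V) (y : Forms V) :
      ExteriorAlgebra.ι ℝ b * (ExteriorAlgebra.ι ℝ a * y) =
        -(ExteriorAlgebra.ι ℝ a * (ExteriorAlgebra.ι ℝ b * y)) := by
    rw [← mul_assoc, ← mul_assoc, ← neg_mul]
    congr 1
    exact eq_neg_of_add_eq_zero_left (ExteriorAlgebra.ι_add_mul_swap _ _)
  rw [opJ_ι]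
  simp only [opJ, LinearMap.sum_apply, LinearMap.sub_apply, Module.End.mul_apply, opE, opI, wedge,
    LinearMap.mulLeft_apply, interior_ι_mul, map_sum, map_sub, map_smul, Finset.sum_mul,
    Finset.mul_sum, ← Finset.sum_add_distrib]
  refine Finset.sum_congr rfl fun j _ => ?_
  simp only [mul_sub, sub_mul, hs, smul_mul_assoc]
  abel

/-- `J` is a derivation. -/
theorem opJ_mul (v : Coframe s V) (x y : Forms V) :
    opJ v (x * y) = opJ v x * y + x * opJ v y := by
  induction x using CliffordAlgebra.left_induction with
  | algebraMap r =>
    rw [Algebra.algebraMap_eq_smul_one]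
    simp [opJ_one]
  | add a b ha hb => rw [add_mul, map_add, map_add, ha, hb]; noncomm_ring
  | ι_mul x a hx =>
    have h (z : Forms V) : opJ v (CliffordAlgebra.ι 0 a * z) =
      opJ v (CliffordAlgebra.ι 0 a) * z + CliffordAlgebra.ι 0 a * opJ v z := opJ_ι_mul v a z
    rw [mul_assoc, h, hx, h]
    noncomm_ring

/-! ### The Lie algebras -/

/-- The operators `L_{jk}` (`j ≠ k`), `V_j` and their adjoints `Λ_{jk}`, `A_j`. -/
def generators [FiniteDimensional ℝ V] (G : LinearMap.BilinForm ℝ (Module.Dual ℝ V))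
    (ω : Fin (s + 1) → Fin (s + 1) → V →ₗ[ℝ] V →ₗ[ℝ] ℝ) (v : Coframe s V) :
    Set (Module.End ℝ (Forms V)) :=
  {T | ∃ j k, j ≠ k ∧ T = wedge (twoFormElement (ω j k))} ∪
  {T | ∃ j, T = opV v j} ∪
  {T | ∃ j k, j ≠ k ∧ IsAdjoint G (wedge (twoFormElement (ω j k))) T} ∪
  {T | ∃ j, IsAdjoint G (opV v j) T}

/-- The real Lie algebra generated by `L_{jk}`, `V_j`, `Λ_{jk}`, `A_j`. -/
def realLieAlgebra [FiniteDimensional ℝ V] (G : LinearMap.BilinForm ℝ (Module.Dual ℝ V))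
    (ω : Fin (s + 1) → Fin (s + 1) → V →ₗ[ℝ] V →ₗ[ℝ] ℝ) (v : Coframe s V) :
    LieSubalgebra ℝ (Module.End ℝ (Forms V)) :=
  LieSubalgebra.lieSpan ℝ (Module.End ℝ (Forms V)) (generators G ω v)

/-- The operator `J` on complexified forms. -/
def opJC (v : Coframe s V) : Module.End ℂ (FormsC V) :=
  (opJ v).baseChange ℂ

/-- The space of complex forms of `J`-weight `α`, i.e. on which `J` acts as `i α`. -/
def weightSpace (v : Coframe s V) (α : ℤ) : Submodule ℂ (FormsC V) :=
  Module.End.eigenspace (opJC v) (Complex.I * (α : ℂ))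

/-! ### The Clifford algebra of `V ⊕ V^*` -/

/-- The Clifford algebra of `V^* ⊕ V`: one has `(α + x)² = α(x)`. -/
abbrev Cliff (V : Type*) [AddCommGroup V] [Module ℝ V] : Type _ :=
  CliffordAlgebra (QuadraticForm.dualProd ℝ V)

/-- The representation of the Clifford algebra on forms: covectors act by wedge product, vectors by
contraction. -/
def rho (V : Type*) [AddCommGroup V] [Module ℝ V] : Cliff V →ₐ[ℝ] Module.End ℝ (Forms V) :=
  CliffordAlgebra.lift (QuadraticForm.dualProd ℝ V)
    ⟨((LinearMap.mul ℝ (Forms V)) ∘ₗ ExteriorAlgebra.ι ℝ).coprod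
        ((CliffordAlgebra.contractLeft (Q := (0 : QuadraticForm ℝ (Module.Dual ℝ V)))) ∘ₗ
          Module.Dual.eval ℝ V), by
      rintro ⟨a, x⟩
      refine LinearMap.ext fun φ => ?_
      have h1 := interior_ι_mul (Module.Dual.eval ℝ V x) a φ
      have h2 := interior_interior (Module.Dual.eval ℝ V x) φ
      have h3 : ExteriorAlgebra.ι ℝ a * (ExteriorAlgebra.ι ℝ a * φ) = 0 := by
        rw [← mul_assoc, ExteriorAlgebra.ι_sq_zero, zero_mul]
      simp only [interior, Module.Dual.eval_apply] at h1 h2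
      simp [mul_add, h1, h2, h3, Algebra.algebraMap_eq_smul_one]⟩

/-- The complexified representation. -/
def rhoC (V : Type*) [AddCommGroup V] [Module ℝ V] :
    ℂ ⊗[ℝ] Cliff V →ₗ[ℂ] Module.End ℂ (FormsC V) :=
  LinearMap.liftBaseChange ℂ
    ((LinearMap.baseChangeHom ℝ ℂ (Forms V) (Forms V)) ∘ₗ (rho V).toLinearMap)

/-- The quadratic part of the Clifford algebra: the image of
`⋀² (V ⊕ V^*)` under `a ∧ b ↦ ½ (a b - b a)`. -/
def quadraticPart (V : Type*) [AddCommGroup V] [Module ℝ V] : Submodule ℝ (Cliff V) :=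
  Submodule.span ℝ {x | ∃ a b, x =
    (1 / 2 : ℝ) • (CliffordAlgebra.ι (QuadraticForm.dualProd ℝ V) a *
        CliffordAlgebra.ι (QuadraticForm.dualProd ℝ V) b -
      CliffordAlgebra.ι (QuadraticForm.dualProd ℝ V) b *
        CliffordAlgebra.ι (QuadraticForm.dualProd ℝ V) a)}

/-- The complex quadratic invariants: elements of the complexified quadratic part of the Clifford
algebra which commute (as operators on forms) with `J`. -/
def quadraticInvariants (v : Coframe s V) : Submodule ℂ (ℂ ⊗[ℝ] Cliff V) :=
  (quadraticPart V).baseChange ℂ ⊓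
    ((Subalgebra.centralizer ℂ {opJC v}).toSubmodule).comap (rhoC V)

end Linear

/-! ### Rank two pointwise `s`-Kähler manifolds -/

/-- The model space of a manifold of dimension `2 (s + 1)`. -/
abbrev Model (s : ℕ) : Type := EuclideanSpace ℝ (Fin (2 * (s + 1)))

/-- The tangent space at a point. -/
abbrev Tangent (s : ℕ) {M : Type*} [TopologicalSpace M] [ChartedSpace (Model s) M] (p : M) : Type :=
  TangentSpace 𝓘(ℝ, Model s) p

/-- A smooth Riemannian metric. -/
abbrev Metric (s : ℕ) (M : Type*) [TopologicalSpace M] [ChartedSpace (Model s) M]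
    [IsManifold 𝓘(ℝ, Model s) (⊤ : ℕ∞) M] : Type _ :=
  Bundle.ContMDiffRiemannianMetric 𝓘(ℝ, Model s) (⊤ : ℕ∞) (Model s)
    (fun p : M => TangentSpace 𝓘(ℝ, Model s) p)

section Manifold

variable {s : ℕ} {M : Type*} [TopologicalSpace M] [ChartedSpace (Model s) M]

instance instFiniteDimensionalTangent (p : M) : FiniteDimensional ℝ (Tangent s p) :=
  inferInstanceAs (FiniteDimensional ℝ (Model s))

/-- A (continuous) bilinear map on the tangent space, seen as a plain bilinear form. -/
def toBilin {p : M} (B : Tangent s p →L[ℝ] Tangent s p →L[ℝ] ℝ) :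
    LinearMap.BilinForm ℝ (Tangent s p) :=
  LinearMap.mk₂ ℝ (fun x y => B x y) (by simp) (by simp) (by simp) (by simp)

variable [IsManifold 𝓘(ℝ, Model s) (⊤ : ℕ∞) M]

theorem Metric.nondegenerate (g : Metric s M) (p : M) : (toBilin (g.inner p)).Nondegenerate := by
  constructor
  · intro x hx
    by_contra h
    exact (g.pos p x h).ne' (hx x)
  · intro x hx
    by_contra h
    exact (g.pos p x h).ne' (hx x)

/-- The metric induced by `g` on the cotangent space at `p`. -/
def Metric.cotangent (g : Metric s M) (p : M) :
    LinearMap.BilinForm ℝ (Module.Dual ℝ (Tangent s p)) :=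
  cometric (toBilin (g.inner p)) (g.nondegenerate p)

/-- The coframe `v` of the cotangent space at `p` is adapted to the metric `g` and the two-forms
`ω_{jk}`: it is orthonormal and `ω_{jk} = v_{1j} ∧ v_{1k} + v_{2j} ∧ v_{2k}`. -/
def IsAdapted (g : Metric s M)
    (ω : Fin (s + 1) → Fin (s + 1) → (p : M) → Tangent s p →L[ℝ] Tangent s p →L[ℝ] ℝ)
    (p : M) (v : Coframe s (Tangent s p)) : Prop :=
  (∀ a b, g.cotangent p (v a) (v b) = if a = b then 1 else 0) ∧
  ∀ j k x y, ω j k p x y = ∑ i, (v (i, j) x * v (i, k) y - v (i, j) y * v (i, k) x)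

variable (s M) in
/-- A (nondegenerate) pointwise `s`-Kähler structure of rank two on a smooth manifold of dimension
`2 (s + 1)`: a smooth Riemannian metric and smooth two-forms `ω_{jk}`, `j, k ∈ {0, …, s}`, such that
every cotangent space has an adapted coframe. (Almost `s`-Kähler and `s`-Kähler structures are
pointwise `s`-Kähler structures which satisfy further integrability conditions.) -/
structure PointwiseSKahler where
  /-- the metric -/
  g : Metric s M
  /-- the two-forms `ω_{jk}` -/
  ω : Fin (s + 1) → Fin (s + 1) → (p : M) → Tangent s p →L[ℝ] Tangent s p →L[ℝ] ℝ
  alternating : ∀ j k p x, ω j k p x x = 0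
  smooth : ∀ j k, ContMDiff 𝓘(ℝ, Model s)
    (𝓘(ℝ, Model s).prod 𝓘(ℝ, Model s →L[ℝ] Model s →L[ℝ] ℝ)) (⊤ : ℕ∞)
    (fun p : M => Bundle.TotalSpace.mk' (Model s →L[ℝ] Model s →L[ℝ] ℝ)
      (E := fun p : M => Tangent s p →L[ℝ] Tangent s p →L[ℝ] ℝ) p (ω j k p))
  exists_adapted : ∀ p, ∃ v : Coframe s (Tangent s p), IsAdapted g ω p v

namespace PointwiseSKahler

variable (X : PointwiseSKahler s M) (p : M)

/-- The adapted coframes at `p`. Such a coframe yields a determination of `J` at `p` (and the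
orientation of the volume forms of the `W_j` that goes with it). -/
abbrev IsAdaptedCoframe (v : Coframe s (Tangent s p)) : Prop :=
  IsAdapted X.g X.ω p v

/-- The fibre at `p` of the real bundle of Lie algebras `𝓛^s_ℝ`, for the determination of `J` given
by `v`: the Lie algebra of operators on `⋀^* T_p^* X` generated by `L_{jk}`, `V_j`, `Λ_{jk}`,
`A_j`. -/
def fibreR (v : Coframe s (Tangent s p)) : LieSubalgebra ℝ (Module.End ℝ (Forms (Tangent s p))) :=
  realLieAlgebra (X.g.cotangent p) (fun j k => toBilin (X.ω j k p)) v

/-- The fibre at `p` of the complex bundle of Lie algebras `𝓛^s_ℂ = 𝓛^s_ℝ ⊗ ℂ`. -/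
abbrev FibreC (v : Coframe s (Tangent s p)) : Type :=
  ℂ ⊗[ℝ] X.fibreR p v

/-- The action of the fibre of `𝓛^s_ℂ` on complexified forms:
`(z ⊗ T) (z' ⊗ φ) = z z' ⊗ T φ`. -/
def action (v : Coframe s (Tangent s p)) :
    X.FibreC p v →ₗ⁅ℂ⁆ Module.End ℂ (FormsC (Tangent s p)) :=
  LieModule.toEnd ℂ (X.FibreC p v) (FormsC (Tangent s p))

end PointwiseSKahler

end Manifold

end SKahler

end

/-!
The operators on complex forms are organised as a fermionic Fock space. Write `z_j = v_{1j} - i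
v_{2j}` for the `(1,0)`-forms of an adapted coframe. The wedge products with the `z_j` and the
contractions dual to the conjugates `z̄_j` all raise the `J`-weight by one; these are the `2s + 2`
operators `up`. The wedge products with the `z̄_j` and the contractions dual to the `z_j` are the
operators `down`, which lower the weight by one. The `up` and `down` operators satisfy the
canonical anticommutation relations (`isCAR_up_down`), so `M ↦ ∑ M_{ab} up_a down_b` is a
homomorphism of Lie algebras `gl(2s+2, ℂ) → End` (`glAction`, `IsCAR.secondQuant_lie`), and the
identity matrix goes to `(s + 1) - i J` (`opJC_eq`).

The generators `L_{jk}`, `V_j` are multiples of the images of `e_{j,k'} - e_{k,j'}` and of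
`e_{j,j'}`, where `j` and `j'` number the two halves of the `up` operators, and the adjoints
`Λ_{jk}`, `A_j` are multiples of the images of the transposed matrices. Adjoints are unique since
the metric on forms is nondegenerate (`eq_zero_of_extMetric`). As soon as there are three indices
`j`, these matrices generate `sl(2s+2, ℂ)` (`mem_of_generators`), so that the complexified Lie
algebra acts by exactly the matrices of trace zero (`mem_range_actionC_iff`).

The form `Ω = z̄_0 ∧ ⋯ ∧ z̄_s` is killed by all the `down` operators and generates the space of
forms, and the number operator has eigenvalue `k` exactly on the span of the products of `k`
operators `up` applied to `Ω` (`IsVacuum.eigenspace_number`). In weight `-s`, that is `k = 1`, one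
finds the standard representation of `gl(2s+2, ℂ)` on the span of the `up_a Ω`. It is faithful of
dimension `2s + 2`; hence `glAction` is injective, which gives the isomorphism with `sl`.

Finally the commutators of `up` and `down` elements split the quadratic part of the Clifford
algebra into the weights `2`, `0`, `-2` of the commutator with `J`. The invariants are the
elements of weight zero (`mem_quadraticInvariants_iff`), which act by `glAction M - ½ tr M`. On
trace zero matrices this is the Lie algebra, and on the identity matrix it is `-i J`.
-/

noncomputable section

namespace SKahler

/-! ### Canonical anticommutation relations -/

section CAR

variable {ι A : Type*} [Ring A]

/-- The normally ordered quadratic operator `∑ M a b c_a d_b` attached to a matrix `M`. -/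
def secondQuant [Fintype ι] (K : Type*) [Field K] [Algebra K A] (c d : ι → A) :
    Matrix ι ι K →ₗ[K] A where
  toFun M := ∑ a, ∑ b, M a b • (c a * d b)
  map_add' M N := by simp [add_smul, Finset.sum_add_distrib]
  map_smul' r M := by simp [Finset.smul_sum, smul_smul]

theorem secondQuant_apply [Fintype ι] {K : Type*} [Field K] [Algebra K A] (c d : ι → A)
    (M : Matrix ι ι K) :
    secondQuant K c d M = ∑ a, ∑ b, M a b • (c a * d b) := rfl

variable [DecidableEq ι]

/-- The canonical anticommutation relations for the creation operators `c a` and the annihilation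
operators `d a`. -/
structure IsCAR (c d : ι → A) : Prop where
  cc : ∀ a b, c a * c b + c b * c a = 0
  dd : ∀ a b, d a * d b + d b * d a = 0
  dc : ∀ a b, d a * c b + c b * d a = if a = b then 1 else 0

theorem IsCAR.symm {c d : ι → A} (h : IsCAR c d) : IsCAR d c where
  cc := h.dd
  dd := h.cc
  dc a b := by rw [add_comm, h.dc]; simp only [eq_comm]

theorem IsCAR.map {B : Type*} [Ring B] {c d : ι → A} (h : IsCAR c d) (f : A →+* B) :
    IsCAR (fun a => f (c a)) (fun a => f (d a)) where
  cc a b := by rw [← map_mul, ← map_mul, ← map_add, h.cc, map_zero]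
  dd a b := by rw [← map_mul, ← map_mul, ← map_add, h.dd, map_zero]
  dc a b := by rw [← map_mul, ← map_mul, ← map_add, h.dc]; split_ifs <;> simp

variable [Fintype ι] {K : Type*} [Field K] [Algebra K A]

theorem secondQuant_single (c d : ι → A) (a b : ι) (r : K) :
    secondQuant K c d (Matrix.single a b r) = r • (c a * d b) := by
  rw [secondQuant_apply, Finset.sum_eq_single a, Finset.sum_eq_single b]
  · simp
  · intro x _ hx; simp [hx.symm]
  · simp
  · intro x _ hx; simp [hx.symm]
  · simp

theorem IsCAR.secondQuant_mul_c {c d : ι → A} (h : IsCAR c d) (M : Matrix ι ι K) (e : ι) :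
    secondQuant K c d M * c e - c e * secondQuant K c d M = ∑ a, M a e • c a := by
  have key (a b : ι) : c a * d b * c e - c e * (c a * d b) = if b = e then c a else 0 := by
    have h1 := eq_sub_of_add_eq (h.dc b e)
    have h2 := eq_neg_of_add_eq_zero_left (h.cc e a)
    rw [mul_assoc, h1, ← mul_assoc (c e), h2]
    split_ifs <;> noncomm_ring
  simp only [secondQuant_apply, Finset.sum_mul, Finset.mul_sum, ← Finset.sum_sub_distrib,
    smul_mul_assoc, mul_smul_comm, ← smul_sub, key]
  simp

theorem IsCAR.secondQuant_mul_d {c d : ι → A} (h : IsCAR c d) (M : Matrix ι ι K) (e : ι) :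
    secondQuant K c d M * d e - d e * secondQuant K c d M = -∑ b, M e b • d b := by
  have key (a b : ι) : c a * d b * d e - d e * (c a * d b) = if e = a then -d b else 0 := by
    have h1 := eq_sub_of_add_eq (h.dc e a)
    have h2 := eq_neg_of_add_eq_zero_left (h.dd b e)
    rw [mul_assoc, h2, ← mul_assoc (d e), h1]
    split_ifs <;> noncomm_ring
  simp only [secondQuant_apply, Finset.sum_mul, Finset.mul_sum, ← Finset.sum_sub_distrib,
    smul_mul_assoc, mul_smul_comm, ← smul_sub, key]
  rw [Finset.sum_comm, ← Finset.sum_neg_distrib]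
  simp

/-- Second quantization is a homomorphism of Lie algebras. -/
theorem IsCAR.secondQuant_lie {c d : ι → A} (h : IsCAR c d) (M N : Matrix ι ι K) :
    secondQuant K c d ⁅M, N⁆ = ⁅secondQuant K c d M, secondQuant K c d N⁆ := by
  have key (e f : ι) : secondQuant K c d M * (c e * d f) - c e * d f * secondQuant K c d M =
      ∑ a, M a e • (c a * d f) - ∑ b, M f b • (c e * d b) := by
    have h1 := h.secondQuant_mul_c M e
    have h2 := h.secondQuant_mul_d M f
    calc _ = (secondQuant K c d M * c e - c e * secondQuant K c d M) * d f +
          c e * (secondQuant K c d M * d f - d f * secondQuant K c d M) := by noncomm_ring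
      _ = _ := by
        rw [h1, h2, Finset.sum_mul, mul_neg, Finset.mul_sum, ← sub_eq_add_neg]
        simp only [smul_mul_assoc, mul_smul_comm]
  rw [Ring.lie_def, Ring.lie_def, map_sub]
  conv_rhs => rw [secondQuant_apply c d N]
  simp only [Finset.sum_mul, Finset.mul_sum, ← Finset.sum_sub_distrib,
    smul_mul_assoc, mul_smul_comm, ← smul_sub, key]
  simp only [smul_sub, Finset.sum_sub_distrib, Finset.smul_sum, smul_smul]
  congr 1
  · simp only [secondQuant_apply, Matrix.mul_apply, Finset.sum_smul]
    rw [Finset.sum_comm]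
    conv_rhs => rw [Finset.sum_comm]
    refine Finset.sum_congr rfl fun f _ => ?_
    conv_lhs => rw [Finset.sum_comm]
    simp only [mul_comm]
  · simp only [secondQuant_apply, Matrix.mul_apply, Finset.sum_smul]
    refine Finset.sum_congr rfl fun e _ => ?_
    rw [Finset.sum_comm]

/-- Second quantization as a homomorphism of Lie algebras. -/
def IsCAR.lieHom {c d : ι → A} (h : IsCAR c d) : Matrix ι ι K →ₗ⁅K⁆ A :=
  { secondQuant K c d with map_lie' := fun {M N} => h.secondQuant_lie M N }

/-- The commutator with the quadratic operator of an identity matrix is the charge `+1` on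
creation operators. -/
theorem IsCAR.number_mul_c {c d : ι → A} (h : IsCAR c d) (e : ι) :
    secondQuant K c d 1 * c e = c e * secondQuant K c d 1 + c e := by
  have := h.secondQuant_mul_c (1 : Matrix ι ι K) e
  simp [Matrix.one_apply] at this
  rw [eq_add_of_sub_eq this, add_comm]

theorem IsCAR.number_mul_d {c d : ι → A} (h : IsCAR c d) (e : ι) :
    secondQuant K c d 1 * d e = d e * secondQuant K c d 1 - d e := by
  have := h.secondQuant_mul_d (1 : Matrix ι ι K) e
  simp [Matrix.one_apply] at this
  rw [sub_eq_iff_eq_add] at this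
  rw [this]; abel

end CAR

/-! ### Fock representations -/

section Fock

variable {ι K F : Type*} [Field K] [AddCommGroup F] [Module K F]

/-- `Ω` is a vacuum vector for the operators `c a`, `d a` (all `d a` kill it), and it generates the
representation. -/
structure IsVacuum (c d : ι → Module.End K F) (Ω : F) : Prop where
  annihilate : ∀ a, d a Ω = 0
  cyclic : ∀ S : Submodule K F, Ω ∈ S → (∀ a, ∀ x ∈ S, c a x ∈ S) → (∀ a, ∀ x ∈ S, d a x ∈ S) →
    S = ⊤

theorem IsVacuum.ne_zero [Nontrivial F] {c d : ι → Module.End K F} {Ω : F} (h : IsVacuum c d Ω) :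
    Ω ≠ 0 := by
  rintro rfl
  have := h.cyclic ⊥ (by simp) (by simp) (by simp)
  exact bot_ne_top this

/-- The span of the vectors `c_{a₁} ⋯ c_{aₖ} Ω`. -/
def fockLevel (c : ι → Module.End K F) (Ω : F) : ℕ → Submodule K F
  | 0 => K ∙ Ω
  | k + 1 => ⨆ a, (fockLevel c Ω k).map (c a)

theorem fockLevel_one (c : ι → Module.End K F) (Ω : F) :
    fockLevel c Ω 1 = Submodule.span K (Set.range fun a => c a Ω) := by
  simp only [fockLevel, Submodule.map_span, Set.image_singleton]
  rw [← Submodule.span_iUnion, Set.iUnion_singleton_eq_range]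

variable [DecidableEq ι]

theorem IsVacuum.iSup_fockLevel {c d : ι → Module.End K F} {Ω : F} (h : IsVacuum c d Ω)
    (hc : IsCAR c d) : ⨆ k, fockLevel c Ω k = ⊤ := by
  have hcS (a : ι) (x : F) (hx : x ∈ ⨆ k, fockLevel c Ω k) : c a x ∈ ⨆ k, fockLevel c Ω k := by
    suffices H : (⨆ k, fockLevel c Ω k) ≤ (⨆ k, fockLevel c Ω k).comap (c a) from H hx
    refine iSup_le fun k y hy => ?_
    refine Submodule.mem_iSup_of_mem (k + 1) ?_
    exact Submodule.mem_iSup_of_mem a (Submodule.mem_map_of_mem hy)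
  refine h.cyclic _ (Submodule.mem_iSup_of_mem 0 (Submodule.mem_span_singleton_self Ω)) hcS ?_
  intro a x hx
  suffices H : (⨆ k, fockLevel c Ω k) ≤ (⨆ k, fockLevel c Ω k).comap (d a) from H hx
  refine iSup_le fun k => ?_
  induction k with
  | zero =>
    rw [fockLevel, Submodule.span_singleton_le_iff_mem, Submodule.mem_comap, h.annihilate]
    exact Submodule.zero_mem _
  | succ k ih =>
    refine iSup_le fun b => ?_
    rintro _ ⟨y, hy, rfl⟩
    have h1 : d a (c b y) + c b (d a y) = (if a = b then (1 : Module.End K F) else 0) y :=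
      congrArg (· y) (hc.dc a b)
    rw [Submodule.mem_comap, eq_sub_of_add_eq h1]
    refine Submodule.sub_mem _ ?_ (hcS b _ (ih hy))
    split_ifs
    · exact Submodule.mem_iSup_of_mem k hy
    · exact Submodule.zero_mem _

theorem IsVacuum.d_c_apply {c d : ι → Module.End K F} {Ω : F} (h : IsVacuum c d Ω)
    (hc : IsCAR c d) (a b : ι) : d a (c b Ω) = if a = b then Ω else 0 := by
  have h1 : d a (c b Ω) + c b (d a Ω) = (if a = b then (1 : Module.End K F) else 0) Ω :=
    congrArg (· Ω) (hc.dc a b)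
  rw [h.annihilate, map_zero, add_zero] at h1
  rw [h1]; split_ifs <;> rfl

theorem IsVacuum.linearIndependent [Nontrivial F] [Finite ι] {c d : ι → Module.End K F} {Ω : F}
    (h : IsVacuum c d Ω) (hc : IsCAR c d) : LinearIndependent K fun a => c a Ω := by
  have := Fintype.ofFinite ι
  rw [Fintype.linearIndependent_iff]
  intro g hg a
  have := congrArg (d a) hg
  simpa [h.d_c_apply hc, h.ne_zero] using this

/-- Exchanging the roles of creation and annihilation operators on a finite set `T` of modes
yields again a Fock representation; its vacuum is obtained by filling the modes in `T`. -/
theorem IsVacuum.exists_flip [CharZero K] {c d : ι → Module.End K F} {Ω : F} (h : IsVacuum c d Ω)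
    (hc : IsCAR c d) (T : Finset ι) :
    ∃ Ω', IsVacuum (fun a => if a ∈ T then d a else c a) (fun a => if a ∈ T then c a else d a)
      Ω' := by
  suffices H : ∃ Ω', (∀ a ∈ T, c a Ω' = 0) ∧ (∀ a ∉ T, d a Ω' = 0) ∧ ∀ S : Submodule K F, Ω' ∈ S →
      (∀ a, ∀ x ∈ S, c a x ∈ S) → (∀ a, ∀ x ∈ S, d a x ∈ S) → S = ⊤ by
    obtain ⟨Ω', h1, h2, h3⟩ := H
    refine ⟨Ω', ?_, ?_⟩
    · intro a
      by_cases ha : a ∈ T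
      · simp [ha, h1 a ha]
      · simp [ha, h2 a ha]
    · intro S hS h4 h5
      refine h3 S hS (fun a x hx => ?_) (fun a x hx => ?_)
      · by_cases ha : a ∈ T
        · simpa [ha] using h5 a x hx
        · simpa [ha] using h4 a x hx
      · by_cases ha : a ∈ T
        · simpa [ha] using h4 a x hx
        · simpa [ha] using h5 a x hx
  induction T using Finset.induction_on with
  | empty => exact ⟨Ω, by simp, fun a _ => h.annihilate a, h.cyclic⟩
  | insert b T hb ih =>
    obtain ⟨Ω', h1, h2, h3⟩ := ih
    have hcc (a e : ι) : c a (c e Ω') = -c e (c a Ω') :=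
      eq_neg_of_add_eq_zero_left (congrArg (· Ω') (hc.cc a e))
    have hdc (a e : ι) : d a (c e Ω') =
        (if a = e then (1 : Module.End K F) else 0) Ω' - c e (d a Ω') :=
      eq_sub_of_add_eq (congrArg (· Ω') (hc.dc a e))
    -- `d b` takes the filled vacuum `c b Ω'` back to `Ω'`, so that it is cyclic again
    refine ⟨c b Ω', fun a ha => ?_, fun a ha => ?_, fun S hS hcS hdS => ?_⟩
    · rcases Finset.mem_insert.1 ha with rfl | ha
      · have h4 : (2 : K) • c a (c a Ω') = 0 := by
          rw [two_smul]; nth_rewrite 1 [hcc a a]; exact neg_add_cancel _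
        exact (smul_eq_zero.1 h4).resolve_left two_ne_zero
      · rw [hcc, h1 a ha, map_zero, neg_zero]
    · rw [Finset.mem_insert, not_or] at ha
      rw [hdc, if_neg ha.1, h2 a ha.2]
      simp
    · refine h3 S ?_ hcS hdS
      have := hdS b _ hS
      rw [hdc, if_pos rfl, h2 b hb] at this
      simpa using this

variable [Fintype ι]

theorem IsVacuum.fockLevel_le {c d : ι → Module.End K F} {Ω : F} (h : IsVacuum c d Ω)
    (hc : IsCAR c d) (k : ℕ) :
    fockLevel c Ω k ≤ (secondQuant K c d 1).eigenspace (k : K) := by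
  induction k with
  | zero =>
    rw [fockLevel, Submodule.span_singleton_le_iff_mem, Module.End.mem_eigenspace_iff]
    simp [secondQuant_apply, LinearMap.sum_apply, h.annihilate]
  | succ k ih =>
    refine iSup_le fun b => ?_
    rintro _ ⟨y, hy, rfl⟩
    have h1 := congrArg (· y) (hc.number_mul_c (K := K) b)
    have h2 := Module.End.mem_eigenspace_iff.1 (ih hy)
    simp only [Module.End.mul_apply, LinearMap.add_apply, h2] at h1
    rw [Module.End.mem_eigenspace_iff, h1]
    simp [add_smul]

/-- In a Fock representation the eigenspaces of the number operator are the obvious ones. -/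
theorem IsVacuum.eigenspace_number [CharZero K] {c d : ι → Module.End K F} {Ω : F}
    (h : IsVacuum c d Ω) (hc : IsCAR c d) (k : ℕ) :
    (secondQuant K c d 1).eigenspace (k : K) = fockLevel c Ω k := by
  refine le_antisymm ?_ (h.fockLevel_le hc k)
  set N : Module.End K F := secondQuant K c d 1
  have hi : Disjoint (N.eigenspace (k : K)) (⨆ (j) (_ : j ≠ k), fockLevel c Ω j) := by
    have := (N.eigenspaces_iSupIndep) (k : K)
    refine this.mono_right (iSup₂_le fun j hj => ?_)
    exact (h.fockLevel_le hc j).trans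
      (le_iSup₂_of_le (f := fun (j : K) (_ : j ≠ k) => N.eigenspace j) (j : K)
        (by exact_mod_cast hj) le_rfl)
  have ht : fockLevel c Ω k ⊔ (⨆ (j) (_ : j ≠ k), fockLevel c Ω j) = ⊤ := by
    rw [eq_top_iff, ← h.iSup_fockLevel hc]
    refine iSup_le fun j => ?_
    by_cases hj : j = k
    · rw [hj]; exact le_sup_left
    · exact le_sup_of_le_right (le_iSup₂_of_le (f := fun j (_ : j ≠ k) => fockLevel c Ω j) j hj
        le_rfl)
  calc N.eigenspace (k : K) = (fockLevel c Ω k ⊔ ⨆ (j) (_ : j ≠ k), fockLevel c Ω j) ⊓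
        N.eigenspace (k : K) := by rw [ht, top_inf_eq]
    _ = fockLevel c Ω k ⊔ (⨆ (j) (_ : j ≠ k), fockLevel c Ω j) ⊓ N.eigenspace (k : K) :=
        sup_inf_assoc_of_le _ (h.fockLevel_le hc k)
    _ = fockLevel c Ω k := by rw [hi.symm.eq_bot, sup_bot_eq]
    _ ≤ _ := le_rfl

/-- The one particle space is the standard representation of the matrix algebra. -/
theorem IsVacuum.secondQuant_c_apply {c d : ι → Module.End K F} {Ω : F}
    (h : IsVacuum c d Ω) (hc : IsCAR c d) (M : Matrix ι ι K) (e : ι) :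
    secondQuant K c d M (c e Ω) = ∑ a, M a e • c a Ω := by
  simp [secondQuant_apply, LinearMap.sum_apply, h.d_c_apply hc, apply_ite]

end Fock

/-! ### Generation of the special linear Lie algebra -/

section Generation

variable {n : Type*} [Fintype n] [DecidableEq n]

theorem lie_single_single {ι : Type*} [Fintype ι] [DecidableEq ι] (a b c d : ι) :
    ⁅(Matrix.single a b 1 : Matrix ι ι ℂ), (Matrix.single c d 1 : Matrix ι ι ℂ)⁆ =
      (if b = c then Matrix.single a d 1 else 0) - if d = a then Matrix.single c b 1 else 0 := by
  rw [Ring.lie_def]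
  congr 1
  · split_ifs with h
    · subst h; simp
    · rw [Matrix.single_mul_single_of_ne _ _ _ _ h]
  · split_ifs with h
    · subst h; simp
    · rw [Matrix.single_mul_single_of_ne _ _ _ _ h]

/-- A Lie algebra of matrices which contains all the off-diagonal matrix units contains all the
matrices of trace zero. -/
theorem mem_of_trace_eq_zero {ι : Type*} [Fintype ι] [DecidableEq ι]
    (K : LieSubalgebra ℂ (Matrix ι ι ℂ)) (h : ∀ a b, a ≠ b → Matrix.single a b 1 ∈ K)
    (M : Matrix ι ι ℂ) (hM : M.trace = 0) : M ∈ K := by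
  have h1 (a b : ι) (r : ℂ) (hab : a ≠ b) : Matrix.single a b r ∈ K := by
    have := K.smul_mem r (h a b hab)
    rwa [Matrix.smul_single, smul_eq_mul, mul_one] at this
  have h2 (a b : ι) : (Matrix.single a a 1 : Matrix ι ι ℂ) - Matrix.single b b 1 ∈ K := by
    by_cases hab : a = b
    · rw [hab, sub_self]; exact K.zero_mem
    · have := K.lie_mem (h a b hab) (h b a (Ne.symm hab))
      rwa [lie_single_single, if_pos rfl, if_pos rfl] at this
  rcases isEmpty_or_nonempty ι with hι | ⟨⟨o⟩⟩
  · rw [Subsingleton.elim M 0]; exact K.zero_mem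
  -- on the diagonal, subtract the zero matrix `tr M • e_{oo}`
  have h3 : M = ∑ a, ∑ b, if a = b then M a a • ((Matrix.single a a 1 : Matrix ι ι ℂ) -
      Matrix.single o o 1) else Matrix.single a b (M a b) := by
    have h4 (a b : ι) : (if a = b then M a a • ((Matrix.single a a 1 : Matrix ι ι ℂ) -
        Matrix.single o o 1) else Matrix.single a b (M a b)) =
        Matrix.single a b (M a b) - if a = b then M a a • Matrix.single o o 1 else 0 := by
      split_ifs with hab
      · subst hab; rw [smul_sub, Matrix.smul_single, smul_eq_mul, mul_one]
      · rw [sub_zero]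
    simp only [h4, Finset.sum_sub_distrib, Finset.sum_ite_eq, Finset.mem_univ, if_true,
      ← Finset.sum_smul]
    have h5 : ∑ a, M a a = 0 := hM
    rw [h5, zero_smul, sub_zero]
    exact Matrix.matrix_eq_sum_single M
  rw [h3]
  refine sum_mem fun a _ => sum_mem fun b _ => ?_
  split_ifs with hab
  · exact K.smul_mem _ (h2 a o)
  · exact h1 a b _ hab

/-- The matrices by which the operators `V_j`, `A_j`, `L_{jk}` and `Λ_{jk}` act on the one particle
space generate `sl`. With only two indices `j` this fails: it takes a third index to tell apart the
two diagonal blocks. -/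
theorem mem_of_generators (hn : 2 < Fintype.card n) (K : LieSubalgebra ℂ (Matrix (n ⊕ n) (n ⊕ n) ℂ))
    (hV : ∀ j, Matrix.single (.inl j) (.inr j) 1 ∈ K)
    (hA : ∀ j, Matrix.single (.inr j) (.inl j) 1 ∈ K)
    (hL : ∀ j k, j ≠ k →
      Matrix.single (.inl j) (.inr k) 1 - Matrix.single (.inl k) (.inr j) 1 ∈ K)
    (hΛ : ∀ j k, j ≠ k →
      Matrix.single (.inr k) (.inl j) 1 - Matrix.single (.inr j) (.inl k) 1 ∈ K)
    (M : Matrix (n ⊕ n) (n ⊕ n) ℂ) (hM : M.trace = 0) : M ∈ K := by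
  have h1 (j l : n) (hjl : j ≠ l) :
      (Matrix.single (.inl j) (.inl l) 1 : Matrix (n ⊕ n) (n ⊕ n) ℂ) +
        Matrix.single (.inr l) (.inr j) 1 ∈ K := by
    have := K.neg_mem (K.lie_mem (hV j) (hΛ j l hjl))
    simp only [lie_sub, lie_single_single] at this
    simp [hjl, hjl.symm] at this
    convert this using 1
  have h2 (j l : n) (hjl : j ≠ l) :
      (Matrix.single (.inl j) (.inl l) 1 : Matrix (n ⊕ n) (n ⊕ n) ℂ) -
        Matrix.single (.inr l) (.inr j) 1 ∈ K := by
    obtain ⟨k, hkj, hkl⟩ : ∃ k, k ≠ j ∧ k ≠ l := by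
      by_contra! H
      have : (Finset.univ : Finset n) ⊆ {j, l} := fun k _ => by
        by_cases hk : k = j
        · simp [hk]
        · simp [H k hk]
      have := Finset.card_le_card this
      have := Finset.card_le_two (a := j) (b := l)
      rw [← Finset.card_univ] at hn
      omega
    have := K.neg_mem (K.lie_mem (hL j k hkj.symm) (hΛ k l hkl))
    simp only [lie_sub, sub_lie, lie_single_single] at this
    simp [hjl, hjl.symm, hkj, hkj.symm, hkl, hkl.symm] at this
    convert this using 1
  have hl (j l : n) (hjl : j ≠ l) :
      (Matrix.single (.inl j) (.inl l) 1 : Matrix (n ⊕ n) (n ⊕ n) ℂ) ∈ K := by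
    have := K.smul_mem (1 / 2 : ℂ) (K.add_mem (h1 j l hjl) (h2 j l hjl))
    convert this using 1
    module
  have hr (j l : n) (hjl : j ≠ l) :
      (Matrix.single (.inr j) (.inr l) 1 : Matrix (n ⊕ n) (n ⊕ n) ℂ) ∈ K := by
    have := K.smul_mem (1 / 2 : ℂ) (K.sub_mem (h1 l j hjl.symm) (h2 l j hjl.symm))
    convert this using 1
    module
  refine mem_of_trace_eq_zero K ?_ M hM
  rintro (j | j) (k | k) hjk
  · exact hl j k fun h => hjk (by rw [h])
  · by_cases h : j = k
    · subst h; exact hV j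
    · have := K.lie_mem (hl j k h) (hV k)
      rw [lie_single_single] at this
      simpa using this
  · by_cases h : j = k
    · subst h; exact hA j
    · have := K.lie_mem (hA j) (hl j k h)
      rw [lie_single_single] at this
      simpa using this
  · exact hr j k fun h => hjk (by rw [h])

end Generation

/-! ### Wedge products and contractions on real forms -/

section RealForms

variable {V : Type*} [AddCommGroup V] [Module ℝ V] {s : ℕ}

theorem isCAR_opE_opI (v : Coframe s V) :
    IsCAR (fun p : Fin 2 × Fin (s + 1) => opE v p.1 p.2) (fun p => opI v p.1 p.2) where
  cc p q := by
    refine LinearMap.ext fun x => ?_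
    change ExteriorAlgebra.ι ℝ (v p) * (ExteriorAlgebra.ι ℝ (v q) * x) +
      ExteriorAlgebra.ι ℝ (v q) * (ExteriorAlgebra.ι ℝ (v p) * x) = 0
    rw [← mul_assoc, ← mul_assoc, ← add_mul, ExteriorAlgebra.ι_add_mul_swap, zero_mul]
  dd p q := by
    refine LinearMap.ext fun x => ?_
    exact add_eq_zero_iff_eq_neg.2 (CliffordAlgebra.contractLeft_comm _ _ x)
  dc p q := by
    refine LinearMap.ext fun x => ?_
    change interior (v.coord p) (ExteriorAlgebra.ι ℝ (v q) * x) +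
      ExteriorAlgebra.ι ℝ (v q) * interior (v.coord p) x = _
    rw [interior_ι_mul, sub_add_cancel, Module.Basis.coord_apply, Module.Basis.repr_self,
      Finsupp.single_apply]
    simp only [eq_comm]
    split_ifs <;> simp

theorem isVacuum_one (v : Coframe s V) :
    IsVacuum (fun p : Fin 2 × Fin (s + 1) => opE v p.1 p.2) (fun p => opI v p.1 p.2) 1 where
  annihilate p := interior_one _
  cyclic S h1 hE _ := by
    refine Submodule.eq_top_iff'.2 fun x => ?_
    induction x using CliffordAlgebra.left_induction with
    | algebraMap r => rw [Algebra.algebraMap_eq_smul_one]; exact S.smul_mem r h1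
    | add a b ha hb => exact S.add_mem ha hb
    | ι_mul x a hx =>
      have h2 : CliffordAlgebra.ι 0 a * x = ∑ p, v.coord p a • opE v p.1 p.2 x := by
        change ExteriorAlgebra.ι ℝ a * x = ∑ p, v.coord p a • (ExteriorAlgebra.ι ℝ (v p) * x)
        conv_lhs => rw [← v.sum_repr a, map_sum, Finset.sum_mul]
        simp
      rw [h2]
      exact S.sum_mem fun p _ => S.smul_mem _ (hE p x hx)

/-- A form killed by all the contractions is constant. -/
theorem mem_span_one_of_opI_eq_zero (v : Coframe s V) (x : Forms V)
    (hx : ∀ i j, opI v i j x = 0) : x ∈ ℝ ∙ (1 : Forms V) := by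
  have h := (isVacuum_one v).eigenspace_number (isCAR_opE_opI v) 0
  have h0 : x ∈ Module.End.eigenspace (secondQuant ℝ
      (fun p : Fin 2 × Fin (s + 1) => opE v p.1 p.2) (fun p => opI v p.1 p.2) 1) ((0 : ℕ) : ℝ) := by
    rw [Module.End.mem_eigenspace_iff]
    simp [secondQuant_apply, LinearMap.sum_apply, hx]
  rw [h] at h0
  exact h0

variable {G : LinearMap.BilinForm ℝ (Module.Dual ℝ V)}

theorem bilin_eq_coord {v : Coframe s V} (hG : ∀ a b, G (v a) (v b) = if a = b then 1 else 0)
    (a : Fin 2 × Fin (s + 1)) : G (v a) = v.coord a := by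
  refine v.ext fun b => ?_
  rw [hG, Module.Basis.coord_apply, Module.Basis.repr_self, Finsupp.single_apply]
  simp only [eq_comm]

theorem extMetric_opE {v : Coframe s V} (hG : ∀ a b, G (v a) (v b) = if a = b then 1 else 0)
    (i : Fin 2) (j : Fin (s + 1)) (x y : Forms V) :
    extMetric G (opE v i j x) y = extMetric G x (opI v i j y) := by
  rw [opI, ← bilin_eq_coord hG]
  exact extMetric_ι_mul G (v (i, j)) x y

/-- The induced metric on forms is nondegenerate: contractions lower a nonzero form in the radical
to a nonzero constant in the radical. -/
theorem eq_zero_of_extMetric {v : Coframe s V}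
    (hG : ∀ a b, G (v a) (v b) = if a = b then 1 else 0) (x : Forms V)
    (hx : ∀ φ, extMetric G φ x = 0) : x = 0 := by
  -- induction on the set of contractions which need not kill `x`
  suffices H : ∀ T : Finset (Fin 2 × Fin (s + 1)), ∀ x : Forms V, (∀ φ, extMetric G φ x = 0) →
      (∀ p ∉ T, opI v p.1 p.2 x = 0) → x = 0 from H Finset.univ x hx (by simp)
  intro T
  induction T using Finset.induction_on with
  | empty =>
    intro x hx h
    obtain ⟨r, rfl⟩ := Submodule.mem_span_singleton.1
      (mem_span_one_of_opI_eq_zero v x fun i j => h (i, j) (by simp))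
    have := hx 1
    rw [map_smul, extMetric_one, map_one, smul_eq_mul, mul_one] at this
    rw [this, zero_smul]
  | insert b T hb ih =>
    intro x hx h
    refine ih x hx fun p hp => ?_
    by_cases hpb : p = b
    · subst hpb
      refine ih _ (fun φ => by rw [← extMetric_opE hG, hx]) fun q hq => ?_
      have h1 : opI v q.1 q.2 (opI v p.1 p.2 x) + opI v p.1 p.2 (opI v q.1 q.2 x) = 0 :=
        congrArg (· x) ((isCAR_opE_opI v).dd q p)
      by_cases hqp : q = p
      · subst hqp; exact interior_interior _ _
      · rw [h q (by simp [hq, hqp]), map_zero, add_zero] at h1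
        exact h1
    · exact h p (by simp [hp, hpb])

theorem IsAdjoint.unique {v : Coframe s V}
    (hG : ∀ a b, G (v a) (v b) = if a = b then 1 else 0) {A B B' : Module.End ℝ (Forms V)}
    (h : IsAdjoint G A B) (h' : IsAdjoint G A B') : B = B' := by
  refine LinearMap.ext fun x => sub_eq_zero.1 (eq_zero_of_extMetric hG _ fun φ => ?_)
  rw [map_sub, ← h, ← h', sub_self]

theorem isAdjoint_opV {v : Coframe s V} (hG : ∀ a b, G (v a) (v b) = if a = b then 1 else 0)
    (j : Fin (s + 1)) : IsAdjoint G (opV v j) (opI v 1 j * opI v 0 j) := fun φ ψ => by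
  simp only [opV, Module.End.mul_apply, extMetric_opE hG]

theorem isAdjoint_opE_mul {v : Coframe s V} (hG : ∀ a b, G (v a) (v b) = if a = b then 1 else 0)
    (j k : Fin (s + 1)) :
    IsAdjoint G (opE v 0 j * opE v 0 k + opE v 1 j * opE v 1 k)
      (opI v 0 k * opI v 0 j + opI v 1 k * opI v 1 j) := fun φ ψ => by
  simp only [Module.End.mul_apply, LinearMap.add_apply, map_add, extMetric_opE hG]

variable [FiniteDimensional ℝ V]

theorem wedge_twoFormElement {v : Coframe s V} {ω : V →ₗ[ℝ] V →ₗ[ℝ] ℝ} {j k : Fin (s + 1)}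
    (h : ∀ x y, ω x y = ∑ i, (v (i, j) x * v (i, k) y - v (i, j) y * v (i, k) x)) :
    wedge (twoFormElement ω) = opE v 0 j * opE v 0 k + opE v 1 j * opE v 1 k := by
  rw [twoFormElement_eq ω (fun i => v (i, j)) (fun i => v (i, k)) h, Fin.sum_univ_two]
  refine LinearMap.ext fun x => ?_
  simp [wedge, opE, add_mul, mul_assoc]

variable {v : Coframe s V} {ω : Fin (s + 1) → Fin (s + 1) → V →ₗ[ℝ] V →ₗ[ℝ] ℝ}

/-- In an adapted coframe the generators are explicit quadratic expressions in the wedge products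
and contractions. -/
theorem mem_generators_iff (hG : ∀ a b, G (v a) (v b) = if a = b then 1 else 0)
    (hω : ∀ j k x y, ω j k x y = ∑ i, (v (i, j) x * v (i, k) y - v (i, j) y * v (i, k) x))
    (T : Module.End ℝ (Forms V)) :
    T ∈ generators G ω v ↔
      (∃ j k, j ≠ k ∧ T = opE v 0 j * opE v 0 k + opE v 1 j * opE v 1 k) ∨
      (∃ j, T = opE v 0 j * opE v 1 j) ∨
      (∃ j k, j ≠ k ∧ T = opI v 0 k * opI v 0 j + opI v 1 k * opI v 1 j) ∨
      (∃ j, T = opI v 1 j * opI v 0 j) := by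
  have h1 (j k) := wedge_twoFormElement (hω j k)
  have h2 (j k : Fin (s + 1)) (T) : IsAdjoint G (opE v 0 j * opE v 0 k + opE v 1 j * opE v 1 k) T ↔
      T = opI v 0 k * opI v 0 j + opI v 1 k * opI v 1 j :=
    ⟨fun h => h.unique hG (isAdjoint_opE_mul hG j k), fun h => h ▸ isAdjoint_opE_mul hG j k⟩
  have h3 (j : Fin (s + 1)) (T) : IsAdjoint G (opE v 0 j * opE v 1 j) T ↔
      T = opI v 1 j * opI v 0 j :=
    ⟨fun h => h.unique hG (isAdjoint_opV hG j), fun h => h ▸ isAdjoint_opV hG j⟩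
  simp only [generators, h1, h2, h3, Set.mem_union, Set.mem_ofPred_eq, or_assoc, opV]

end RealForms

/-! ### Rotation to operators of definite weight -/

section Rotation

theorem IsCAR.flip {ι A : Type*} [DecidableEq ι] [Ring A] {c d : ι → A} (h : IsCAR c d)
    (T : Finset ι) :
    IsCAR (fun a => if a ∈ T then d a else c a) (fun a => if a ∈ T then c a else d a) where
  cc a b := by
    by_cases ha : a ∈ T <;> by_cases hb : b ∈ T <;> simp only [ha, hb, if_true, if_false]
    · exact h.dd a b
    · rw [h.dc, if_neg (ne_of_mem_of_not_mem ha hb)]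
    · rw [h.symm.dc, if_neg (ne_of_mem_of_not_mem hb ha).symm]
    · exact h.cc a b
  dd a b := by
    by_cases ha : a ∈ T <;> by_cases hb : b ∈ T <;> simp only [ha, hb, if_true, if_false]
    · exact h.cc a b
    · rw [h.symm.dc, if_neg (ne_of_mem_of_not_mem ha hb)]
    · rw [h.dc, if_neg (ne_of_mem_of_not_mem hb ha).symm]
    · exact h.dd a b
  dc a b := by
    by_cases ha : a ∈ T <;> by_cases hb : b ∈ T <;> simp only [ha, hb, if_true, if_false]
    · exact h.symm.dc a b
    · rw [h.cc, if_neg (ne_of_mem_of_not_mem ha hb)]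
    · rw [h.dd, if_neg (ne_of_mem_of_not_mem hb ha).symm]
    · exact h.dc a b

variable {n A : Type*} [AddCommGroup A] [Module ℂ A]

/-- The wedge products with the forms `z_j = v_{1j} - i v_{2j}` (left summand) of type `(1,0)` and
with their conjugates (right summand), in terms of the wedge products `e` with the `v_{ij}`. -/
def wedgeZ (e : Fin 2 × n → A) : n ⊕ n → A :=
  Sum.elim (fun j => e (0, j) - Complex.I • e (1, j)) (fun j => e (0, j) + Complex.I • e (1, j))

/-- The contractions dual to `wedgeZ`, in terms of the contractions `i` dual to the `v_{ij}`. -/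
def contractZ (i : Fin 2 × n → A) : n ⊕ n → A :=
  Sum.elim (fun j => (1 / 2 : ℂ) • (i (0, j) + Complex.I • i (1, j)))
    (fun j => (1 / 2 : ℂ) • (i (0, j) - Complex.I • i (1, j)))

/-- The operators which raise the weight by one: the wedge products with the `z_j` and the
contractions dual to their conjugates. -/
def raising (e i : Fin 2 × n → A) : n ⊕ n → A :=
  Sum.elim (fun j => wedgeZ e (.inl j)) (fun j => contractZ i (.inr j))

/-- The operators which lower the weight by one: the contractions dual to the `z_j` and the
wedge products with their conjugates. -/
def lowering (e i : Fin 2 × n → A) : n ⊕ n → A :=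
  Sum.elim (fun j => contractZ i (.inl j)) (fun j => wedgeZ e (.inr j))

theorem map_raising {B : Type*} [AddCommGroup B] [Module ℂ B] (f : A →ₗ[ℂ] B)
    (e i : Fin 2 × n → A) (a : n ⊕ n) :
    f (raising e i a) = raising (fun p => f (e p)) (fun p => f (i p)) a := by
  rcases a with j | j <;> simp [raising, wedgeZ, contractZ]

theorem map_lowering {B : Type*} [AddCommGroup B] [Module ℂ B] (f : A →ₗ[ℂ] B)
    (e i : Fin 2 × n → A) (a : n ⊕ n) :
    f (lowering e i a) = lowering (fun p => f (e p)) (fun p => f (i p)) a := by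
  rcases a with j | j <;> simp [lowering, wedgeZ, contractZ]

theorem eq_raising_lowering_wedge_zero (e i : Fin 2 × n → A) (j : n) :
    e (0, j) = (1 / 2 : ℂ) • (raising e i (.inl j) + lowering e i (.inr j)) := by
  simp only [raising, lowering, wedgeZ, Sum.elim_inl, Sum.elim_inr]
  module

theorem eq_raising_lowering_wedge_one (e i : Fin 2 × n → A) (j : n) :
    e (1, j) = (Complex.I / 2) • (raising e i (.inl j) - lowering e i (.inr j)) := by
  simp only [raising, lowering, wedgeZ, Sum.elim_inl, Sum.elim_inr]
  match_scalars <;> first | ring1 | linear_combination Complex.I_mul_I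

theorem eq_raising_lowering_contract_zero (e i : Fin 2 × n → A) (j : n) :
    i (0, j) = lowering e i (.inl j) + raising e i (.inr j) := by
  simp only [raising, lowering, contractZ, Sum.elim_inl, Sum.elim_inr]
  module

theorem eq_raising_lowering_contract_one (e i : Fin 2 × n → A) (j : n) :
    i (1, j) = Complex.I • (raising e i (.inr j) - lowering e i (.inl j)) := by
  simp only [raising, lowering, contractZ, Sum.elim_inl, Sum.elim_inr]
  match_scalars <;> first | ring1 | linear_combination Complex.I_mul_I

theorem IsVacuum.wedgeZ {F : Type*} [AddCommGroup F] [Module ℂ F]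
    {e i : Fin 2 × n → Module.End ℂ F} {Ω : F} (h : IsVacuum e i Ω) :
    IsVacuum (SKahler.wedgeZ e) (contractZ i) Ω where
  annihilate := by rintro (j | j) <;> simp [contractZ, h.annihilate]
  cyclic S hS hc hd := by
    refine h.cyclic S hS ?_ ?_
    · rintro ⟨a, j⟩ x hx
      have h1 := hc (.inl j) x hx
      have h2 := hc (.inr j) x hx
      fin_cases a
      · change e (0, j) x ∈ S
        rw [eq_raising_lowering_wedge_zero e i j]
        exact S.smul_mem _ (S.add_mem h1 h2)
      · change e (1, j) x ∈ S
        rw [eq_raising_lowering_wedge_one e i j]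
        exact S.smul_mem _ (S.sub_mem h1 h2)
    · rintro ⟨a, j⟩ x hx
      have h1 := hd (.inl j) x hx
      have h2 := hd (.inr j) x hx
      fin_cases a
      · change i (0, j) x ∈ S
        rw [eq_raising_lowering_contract_zero e i j]
        exact S.add_mem h1 h2
      · change i (1, j) x ∈ S
        rw [eq_raising_lowering_contract_one e i j]
        exact S.smul_mem _ (S.sub_mem h2 h1)

end Rotation

section RotationCAR

variable {n : Type*} [DecidableEq n]

theorem IsCAR.wedgeZ {A : Type*} [Ring A] [Algebra ℂ A] {e i : Fin 2 × n → A} (h : IsCAR e i) :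
    IsCAR (SKahler.wedgeZ e) (contractZ i) := by
  have anti (x y z w : A) (r t : ℂ) : (x + r • y) * (z + t • w) + (z + t • w) * (x + r • y) =
      (x * z + z * x) + t • (x * w + w * x) + r • (y * z + z * y) + (r * t) • (y * w + w * y) := by
    simp only [add_mul, mul_add, smul_mul_assoc, mul_smul_comm, smul_smul, smul_add, mul_comm t r]
    abel
  have hI : Complex.I * Complex.I = -1 := Complex.I_mul_I
  constructor
  · rintro (j | j) (k | k) <;>
      simp only [SKahler.wedgeZ, Sum.elim_inl, Sum.elim_inr, sub_eq_add_neg, ← neg_smul] <;>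
      rw [anti] <;> simp [h.cc]
  · rintro (j | j) (k | k) <;>
      simp only [contractZ, Sum.elim_inl, Sum.elim_inr, sub_eq_add_neg, ← neg_smul,
        smul_mul_assoc, mul_smul_comm, ← smul_add] <;>
      rw [anti] <;> simp [h.dd]
  · rintro (j | j) (k | k) <;>
      simp only [SKahler.wedgeZ, contractZ, Sum.elim_inl, Sum.elim_inr, sub_eq_add_neg, ← neg_smul,
        smul_mul_assoc, mul_smul_comm, ← smul_add] <;>
      rw [anti] <;> simp only [h.dc, Prod.mk.injEq, Sum.inl.injEq, Sum.inr.injEq, reduceCtorEq] <;>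
      by_cases hjk : j = k <;> simp [hjk, hI]
    all_goals module

/-- The raising and lowering operators arise from `wedgeZ` and `contractZ` by exchanging creation
and annihilation operators for the conjugates of the `z_j`. -/
theorem raising_eq_flip [Fintype n] {A : Type*} [AddCommGroup A] [Module ℂ A]
    (e i : Fin 2 × n → A) :
    (raising e i = fun a => if a ∈ Finset.univ.map (Function.Embedding.inr (α := n)) then
      contractZ i a else wedgeZ e a) ∧
    (lowering e i = fun a => if a ∈ Finset.univ.map (Function.Embedding.inr (α := n)) then
      wedgeZ e a else contractZ i a) := by
  constructor <;> ext (j | j) <;> simp [raising, lowering]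

theorem IsCAR.raising [Fintype n] {A : Type*} [Ring A] [Algebra ℂ A] {e i : Fin 2 × n → A}
    (h : IsCAR e i) : IsCAR (SKahler.raising e i) (lowering e i) := by
  rw [(raising_eq_flip e i).1, (raising_eq_flip e i).2]
  exact h.wedgeZ.flip _

/-- The lowest weight vector: a form killed by all the operators which lower the weight. -/
theorem IsVacuum.exists_raising [Fintype n] {F : Type*} [AddCommGroup F] [Module ℂ F]
    {e i : Fin 2 × n → Module.End ℂ F} {Ω : F} (h : IsVacuum e i Ω) (hc : IsCAR e i) :
    ∃ Ω', IsVacuum (raising e i) (lowering e i) Ω' := by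
  rw [(raising_eq_flip e i).1, (raising_eq_flip e i).2]
  exact h.wedgeZ.exists_flip hc.wedgeZ _

section Products

variable {A : Type*} [Ring A] [Algebra ℂ A] {e i : Fin 2 × n → A}

theorem IsCAR.c_sq {ι : Type*} [DecidableEq ι] {c d : ι → A} (h : IsCAR c d) (a : ι) :
    c a * c a = 0 := by
  have h1 : (2 : ℂ) • (c a * c a) = 0 := by rw [two_smul, h.cc]
  exact (smul_eq_zero_iff_right two_ne_zero).1 h1

theorem IsCAR.wedge_mul_wedge_self (h : IsCAR e i) (j : n) :
    e (0, j) * e (1, j) = (-Complex.I / 2) •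
      (SKahler.raising e i (.inl j) * lowering e i (.inr j)) := by
  have h3 := eq_neg_of_add_eq_zero_left (h.cc (1, j) (0, j))
  simp only [SKahler.raising, lowering, SKahler.wedgeZ, Sum.elim_inl, Sum.elim_inr, sub_mul,
    mul_add, smul_mul_assoc, mul_smul_comm, h.c_sq, h3]
  match_scalars
  linear_combination Complex.I_mul_I

theorem IsCAR.contract_mul_contract_self (h : IsCAR e i) (j : n) :
    i (1, j) * i (0, j) = (2 * Complex.I) •
      (SKahler.raising e i (.inr j) * lowering e i (.inl j)) := by
  have h3 := eq_neg_of_add_eq_zero_left (h.dd (0, j) (1, j))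
  simp only [SKahler.raising, lowering, contractZ, Sum.elim_inl, Sum.elim_inr, sub_mul,
    mul_add, smul_mul_assoc, mul_smul_comm, h.symm.c_sq, h3]
  match_scalars
  linear_combination Complex.I_mul_I

theorem IsCAR.wedge_mul_wedge_add (h : IsCAR e i) (j k : n) :
    e (0, j) * e (0, k) + e (1, j) * e (1, k) = (1 / 2 : ℂ) •
      (SKahler.raising e i (.inl j) * lowering e i (.inr k) -
        SKahler.raising e i (.inl k) * lowering e i (.inr j)) := by
  have h1 := eq_neg_of_add_eq_zero_left (h.cc (0, k) (0, j))
  have h2 := eq_neg_of_add_eq_zero_left (h.cc (0, k) (1, j))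
  have h3 := eq_neg_of_add_eq_zero_left (h.cc (1, k) (0, j))
  have h4 := eq_neg_of_add_eq_zero_left (h.cc (1, k) (1, j))
  simp only [SKahler.raising, lowering, SKahler.wedgeZ, Sum.elim_inl, Sum.elim_inr, sub_mul,
    mul_add, smul_mul_assoc, mul_smul_comm, h1, h2, h3, h4]
  match_scalars <;> first | ring1 | linear_combination Complex.I_mul_I

theorem IsCAR.contract_mul_contract_add (h : IsCAR e i) (j k : n) :
    i (0, k) * i (0, j) + i (1, k) * i (1, j) = (2 : ℂ) •
      (SKahler.raising e i (.inr k) * lowering e i (.inl j) -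
        SKahler.raising e i (.inr j) * lowering e i (.inl k)) := by
  have h1 := eq_neg_of_add_eq_zero_left (h.dd (0, j) (0, k))
  have h2 := eq_neg_of_add_eq_zero_left (h.dd (0, j) (1, k))
  have h3 := eq_neg_of_add_eq_zero_left (h.dd (1, j) (0, k))
  have h4 := eq_neg_of_add_eq_zero_left (h.dd (1, j) (1, k))
  simp only [SKahler.raising, lowering, contractZ, Sum.elim_inl, Sum.elim_inr, sub_mul,
    mul_add, smul_mul_assoc, mul_smul_comm, h1, h2, h3, h4]
  match_scalars <;> first | ring1 | linear_combination Complex.I_mul_I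

theorem IsCAR.wedge_mul_contract_sub (h : IsCAR e i) (j : n) :
    e (1, j) * i (0, j) - e (0, j) * i (1, j) = Complex.I •
      (SKahler.raising e i (.inl j) * lowering e i (.inl j) +
        SKahler.raising e i (.inr j) * lowering e i (.inr j) - 1) := by
  have h1 := eq_sub_of_add_eq (h.dc (0, j) (0, j))
  have h2 := eq_sub_of_add_eq (h.dc (0, j) (1, j))
  have h3 := eq_sub_of_add_eq (h.dc (1, j) (0, j))
  have h4 := eq_sub_of_add_eq (h.dc (1, j) (1, j))
  simp only [Prod.mk.injEq, zero_ne_one, one_ne_zero, false_and, if_true, if_false]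
    at h1 h2 h3 h4
  simp only [SKahler.raising, lowering, contractZ, SKahler.wedgeZ, Sum.elim_inl, Sum.elim_inr,
    sub_mul, mul_add, smul_mul_assoc, mul_smul_comm, h1, h2, h3, h4]
  match_scalars <;> first | ring1 | linear_combination Complex.I_mul_I |
    linear_combination -Complex.I_mul_I |
    linear_combination Complex.I / 2 * Complex.I_mul_I

end Products

end RotationCAR

/-! ### Complex forms -/

section ComplexForms

variable {V : Type*} [AddCommGroup V] [Module ℝ V] {s : ℕ}

theorem eq_zero_of_tmul_add {N : Type*} [AddCommGroup N] [Module ℝ N] {x y : N}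
    (h : (1 : ℂ) ⊗ₜ[ℝ] x + Complex.I ⊗ₜ[ℝ] y = 0) : x = 0 ∧ y = 0 := by
  constructor
  · simpa using congrArg ((TensorProduct.lid ℝ N).toLinearMap ∘ₗ LinearMap.rTensor N Complex.reLm) h
  · simpa using congrArg ((TensorProduct.lid ℝ N).toLinearMap ∘ₗ LinearMap.rTensor N Complex.imLm) h

theorem exists_tmul_add {N : Type*} [AddCommGroup N] [Module ℝ N] (z : ℂ ⊗[ℝ] N) :
    ∃ x y, z = (1 : ℂ) ⊗ₜ[ℝ] x + Complex.I ⊗ₜ[ℝ] y := by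
  induction z with
  | zero => exact ⟨0, 0, by simp⟩
  | add a b ha hb =>
    obtain ⟨x, y, rfl⟩ := ha
    obtain ⟨x', y', rfl⟩ := hb
    exact ⟨x + x', y + y', by rw [TensorProduct.tmul_add, TensorProduct.tmul_add]; abel⟩
  | tmul r x =>
    refine ⟨r.re • x, r.im • x, ?_⟩
    rw [← TensorProduct.smul_tmul, ← TensorProduct.smul_tmul, ← TensorProduct.add_tmul]
    congr 1
    simp

/-- The complexification of a real operator on forms. -/
abbrev complexify : Module.End ℝ (Forms V) →ₐ[ℝ] Module.End ℂ (FormsC V) :=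
  Module.End.baseChangeHom ℝ ℂ (Forms V)

/-- The wedge products with the elements of a coframe, on complex forms. -/
def wedgeC (v : Coframe s V) (p : Fin 2 × Fin (s + 1)) : Module.End ℂ (FormsC V) :=
  complexify (opE v p.1 p.2)

/-- The contractions dual to a coframe, on complex forms. -/
def contractC (v : Coframe s V) (p : Fin 2 × Fin (s + 1)) : Module.End ℂ (FormsC V) :=
  complexify (opI v p.1 p.2)

theorem isCAR_complex (v : Coframe s V) : IsCAR (wedgeC v) (contractC v) :=
  (isCAR_opE_opI v).map (complexify (V := V)).toRingHom

theorem isVacuum_complex (v : Coframe s V) :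
    IsVacuum (wedgeC v) (contractC v) ((1 : ℂ) ⊗ₜ[ℝ] (1 : Forms V)) where
  annihilate p := by
    change (1 : ℂ) ⊗ₜ[ℝ] (opI v p.1 p.2 1) = 0
    rw [(isVacuum_one v).annihilate p, TensorProduct.tmul_zero]
  cyclic S h1 hE hI := by
    have h : (S.restrictScalars ℝ).comap (TensorProduct.mk ℝ ℂ (Forms V) 1) = ⊤ :=
      (isVacuum_one v).cyclic _ h1 (fun p x hx => hE p _ hx) (fun p x hx => hI p _ hx)
    refine Submodule.eq_top_iff'.2 fun x => ?_
    induction x using TensorProduct.induction_on with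
    | zero => exact S.zero_mem
    | add a b ha hb => exact S.add_mem ha hb
    | tmul r x =>
      have hx : (1 : ℂ) ⊗ₜ[ℝ] x ∈ S := by
        have : x ∈ (S.restrictScalars ℝ).comap (TensorProduct.mk ℝ ℂ (Forms V) 1) := by
          rw [h]; trivial
        exact this
      have := S.smul_mem r hx
      rwa [TensorProduct.smul_tmul', smul_eq_mul, mul_one] at this

instance : Nontrivial (FormsC V) := by
  refine ⟨⟨(1 : ℂ) ⊗ₜ[ℝ] (1 : Forms V), 0, fun h => ?_⟩⟩
  refine one_ne_zero (α := Forms V) (eq_zero_of_tmul_add (y := (0 : Forms V)) ?_).1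
  rw [h, TensorProduct.tmul_zero, add_zero]

/-- The operators of weight one attached to a coframe. -/
abbrev up (v : Coframe s V) : Fin (s + 1) ⊕ Fin (s + 1) → Module.End ℂ (FormsC V) :=
  raising (wedgeC v) (contractC v)

/-- The operators of weight minus one attached to a coframe. -/
abbrev down (v : Coframe s V) : Fin (s + 1) ⊕ Fin (s + 1) → Module.End ℂ (FormsC V) :=
  lowering (wedgeC v) (contractC v)

theorem isCAR_up_down (v : Coframe s V) : IsCAR (up v) (down v) := (isCAR_complex v).raising

theorem exists_isVacuum (v : Coframe s V) : ∃ Ω, IsVacuum (up v) (down v) Ω :=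
  (isVacuum_complex v).exists_raising (isCAR_complex v)

/-- The action on complex forms of the matrix Lie algebra `gl(2s+2, ℂ)`. -/
abbrev glAction (v : Coframe s V) : Matrix (Fin (s + 1) ⊕ Fin (s + 1)) (Fin (s + 1) ⊕ Fin (s + 1)) ℂ
    →ₗ⁅ℂ⁆ Module.End ℂ (FormsC V) := (isCAR_up_down v).lieHom

theorem glAction_apply (v : Coframe s V)
    (M : Matrix (Fin (s + 1) ⊕ Fin (s + 1)) (Fin (s + 1) ⊕ Fin (s + 1)) ℂ) :
    glAction v M = secondQuant ℂ (up v) (down v) M := rfl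

theorem glAction_single (v : Coframe s V) (a b : Fin (s + 1) ⊕ Fin (s + 1)) :
    glAction v (Matrix.single a b 1) = up v a * down v b := by
  rw [glAction_apply, secondQuant_single, one_smul]

/-- Up to a scalar and a shift, `J` is the number operator: the image of the identity matrix. -/
theorem opJC_eq (v : Coframe s V) :
    opJC v = Complex.I • (glAction v 1 - ((s + 1 : ℕ) : ℂ) • 1) := by
  have h (j : Fin (s + 1)) := (isCAR_complex v).wedge_mul_contract_sub j
  have h1 : opJC v = ∑ j, (wedgeC v (1, j) * contractC v (0, j) -
      wedgeC v (0, j) * contractC v (1, j)) := by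
    change complexify (opJ v) = _
    simp only [opJ, map_sum, map_sub, map_mul]
    rfl
  rw [h1]
  simp only [h]
  rw [← Finset.smul_sum, glAction_apply, secondQuant_apply, Fintype.sum_sum_type]
  simp [Matrix.one_apply, Finset.sum_add_distrib, add_smul, Nat.cast_smul_eq_nsmul]

theorem opJC_mul_up (v : Coframe s V) (a : Fin (s + 1) ⊕ Fin (s + 1)) :
    opJC v * up v a = up v a * opJC v + Complex.I • up v a := by
  have h := (isCAR_up_down v).number_mul_c (K := ℂ) a
  rw [← glAction_apply] at h
  simp only [opJC_eq, smul_mul_assoc, mul_smul_comm, sub_mul, mul_sub, h, one_mul, mul_one]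
  module

theorem opJC_mul_down (v : Coframe s V) (a : Fin (s + 1) ⊕ Fin (s + 1)) :
    opJC v * down v a = down v a * opJC v - Complex.I • down v a := by
  have h := (isCAR_up_down v).number_mul_d (K := ℂ) a
  rw [← glAction_apply] at h
  simp only [opJC_eq, smul_mul_assoc, mul_smul_comm, sub_mul, mul_sub, h, one_mul, mul_one]
  module

theorem glAction_comm_opJC (v : Coframe s V)
    (M : Matrix (Fin (s + 1) ⊕ Fin (s + 1)) (Fin (s + 1) ⊕ Fin (s + 1)) ℂ) :
    opJC v * glAction v M = glAction v M * opJC v := by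
  have h : ⁅glAction v 1, glAction v M⁆ = 0 := by
    rw [← LieHom.map_lie, Ring.lie_def, one_mul, mul_one, sub_self, map_zero]
  rw [Ring.lie_def, sub_eq_zero] at h
  simp only [opJC_eq, smul_mul_assoc, mul_smul_comm, sub_mul, mul_sub, h, one_mul, mul_one]

/-- The forms of weight `-s` are the one particle states. -/
theorem weightSpace_eq (v : Coframe s V) {Ω : FormsC V} (hΩ : IsVacuum (up v) (down v) Ω) :
    weightSpace v (-(s : ℤ)) = Submodule.span ℂ (Set.range fun a => up v a Ω) := by
  rw [← fockLevel_one, ← hΩ.eigenspace_number (isCAR_up_down v) 1, ← glAction_apply]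
  ext x
  rw [weightSpace, Module.End.mem_eigenspace_iff, Module.End.mem_eigenspace_iff, opJC_eq]
  simp only [LinearMap.smul_apply, LinearMap.sub_apply, Module.End.one_apply, mul_smul]
  rw [(smul_right_injective _ Complex.I_ne_zero).eq_iff, sub_eq_iff_eq_add, ← add_smul]
  simp

theorem finrank_weightSpace (v : Coframe s V) :
    Module.finrank ℂ (weightSpace v (-(s : ℤ))) = 2 * s + 2 := by
  obtain ⟨Ω, hΩ⟩ := exists_isVacuum v
  rw [weightSpace_eq v hΩ, finrank_span_eq_card (hΩ.linearIndependent (isCAR_up_down v))]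
  simp
  ring

/-- The matrices act faithfully on the forms of weight `-s`: this is the standard
representation. -/
theorem eq_zero_of_glAction (v : Coframe s V)
    (M : Matrix (Fin (s + 1) ⊕ Fin (s + 1)) (Fin (s + 1) ⊕ Fin (s + 1)) ℂ)
    (h : ∀ φ ∈ weightSpace v (-(s : ℤ)), glAction v M φ = 0) : M = 0 := by
  obtain ⟨Ω, hΩ⟩ := exists_isVacuum v
  ext a b
  have h1 := h (up v b Ω) (by
    rw [weightSpace_eq v hΩ]; exact Submodule.subset_span (Set.mem_range_self b))
  rw [glAction_apply, hΩ.secondQuant_c_apply (isCAR_up_down v)] at h1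
  exact Fintype.linearIndependent_iff.1 (hΩ.linearIndependent (isCAR_up_down v)) _ h1 a

theorem glAction_injective (v : Coframe s V) : Function.Injective (glAction v) := by
  rw [← LieHom.coe_toLinearMap, ← LinearMap.ker_eq_bot, LinearMap.ker_eq_bot']
  intro M hM
  refine eq_zero_of_glAction v M fun φ _ => ?_
  rw [LieHom.coe_toLinearMap] at hM
  rw [hM, LinearMap.zero_apply]

end ComplexForms

/-! ### The Lie algebra generated by the operators of an `s`-Kähler structure -/

section Main

variable {V : Type*} [AddCommGroup V] [Module ℝ V] {s : ℕ}

/-- The action of the complexification of a real Lie algebra of operators on complex forms. -/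
abbrev actionC (L : LieSubalgebra ℝ (Module.End ℝ (Forms V))) :
    ℂ ⊗[ℝ] L →ₗ⁅ℂ⁆ Module.End ℂ (FormsC V) :=
  LieModule.toEnd ℂ (ℂ ⊗[ℝ] L) (FormsC V)

theorem actionC_tmul (L : LieSubalgebra ℝ (Module.End ℝ (Forms V))) (z : ℂ) (T : L) :
    actionC L (z ⊗ₜ[ℝ] T) = z • complexify (T : Module.End ℝ (Forms V)) := by
  refine LinearMap.ext fun x => ?_
  induction x using TensorProduct.induction_on with
  | zero => simp
  | add a b ha hb => rw [map_add, map_add, ha, hb]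
  | tmul r x =>
    change (z * r) ⊗ₜ[ℝ] ((T : Module.End ℝ (Forms V)) x) =
      z • (r ⊗ₜ[ℝ] ((T : Module.End ℝ (Forms V)) x))
    rw [TensorProduct.smul_tmul', smul_eq_mul]

theorem actionC_injective (L : LieSubalgebra ℝ (Module.End ℝ (Forms V))) :
    Function.Injective (actionC L) := by
  rw [← LieHom.coe_toLinearMap, ← LinearMap.ker_eq_bot, LinearMap.ker_eq_bot']
  intro x hx
  obtain ⟨S, T, rfl⟩ := exists_tmul_add x
  rw [LieHom.coe_toLinearMap, map_add, actionC_tmul, actionC_tmul] at hx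
  have h (φ : Forms V) : (S : Module.End ℝ (Forms V)) φ = 0 ∧
      (T : Module.End ℝ (Forms V)) φ = 0 := by
    refine eq_zero_of_tmul_add ?_
    have h1 := congrArg (· ((1 : ℂ) ⊗ₜ[ℝ] φ)) hx
    change (1 : ℂ) • ((1 : ℂ) ⊗ₜ[ℝ] (S : Module.End ℝ (Forms V)) φ) +
      Complex.I • ((1 : ℂ) ⊗ₜ[ℝ] (T : Module.End ℝ (Forms V)) φ) = 0 at h1
    rwa [one_smul, TensorProduct.smul_tmul', smul_eq_mul, mul_one] at h1
  have hS : S = 0 := Subtype.ext (LinearMap.ext fun φ => (h φ).1)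
  have hT : T = 0 := Subtype.ext (LinearMap.ext fun φ => (h φ).2)
  rw [hS, hT, TensorProduct.tmul_zero, TensorProduct.tmul_zero, add_zero]

variable [FiniteDimensional ℝ V] {G : LinearMap.BilinForm ℝ (Module.Dual ℝ V)}
  {v : Coframe s V} {ω : Fin (s + 1) → Fin (s + 1) → V →ₗ[ℝ] V →ₗ[ℝ] ℝ}

/-- The generators act as matrices of trace zero. -/
theorem complexify_mem_sl (hG : ∀ a b, G (v a) (v b) = if a = b then 1 else 0)
    (hω : ∀ j k x y, ω j k x y = ∑ i, (v (i, j) x * v (i, k) y - v (i, j) y * v (i, k) x))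
    (T : Module.End ℝ (Forms V)) (hT : T ∈ realLieAlgebra G ω v) :
    ∃ M, M.trace = 0 ∧ glAction v M = complexify T := by
  have hc := isCAR_complex v
  refine LieSubalgebra.lieSpan_induction (R := ℝ) (L := Module.End ℝ (Forms V))
    (s := generators G ω v)
    (p := fun T _ => ∃ M, Matrix.trace M = 0 ∧ glAction v M = complexify T) ?_ ?_ ?_ ?_ ?_ hT
  · intro T hT
    rcases (mem_generators_iff hG hω T).1 hT with
      ⟨j, k, -, rfl⟩ | ⟨j, rfl⟩ | ⟨j, k, -, rfl⟩ | ⟨j, rfl⟩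
    · refine ⟨(1 / 2 : ℂ) • (Matrix.single (.inl j) (.inr k) 1 -
        Matrix.single (.inl k) (.inr j) 1), ?_, ?_⟩
      · simp
      · rw [map_smul, map_sub, glAction_single, glAction_single,
          ← hc.wedge_mul_wedge_add, map_add, map_mul, map_mul]
        rfl
    · refine ⟨(-Complex.I / 2) • Matrix.single (.inl j) (.inr j) 1, ?_, ?_⟩
      · simp
      · rw [map_smul, glAction_single, ← hc.wedge_mul_wedge_self, map_mul]
        rfl
    · refine ⟨(2 : ℂ) • (Matrix.single (.inr k) (.inl j) 1 -
        Matrix.single (.inr j) (.inl k) 1), ?_, ?_⟩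
      · simp
      · rw [map_smul, map_sub, glAction_single, glAction_single,
          ← hc.contract_mul_contract_add, map_add, map_mul, map_mul]
        rfl
    · refine ⟨(2 * Complex.I) • Matrix.single (.inr j) (.inl j) 1, ?_, ?_⟩
      · simp
      · rw [map_smul, glAction_single, ← hc.contract_mul_contract_self, map_mul]
        rfl
  · exact ⟨0, by simp, by simp⟩
  · rintro S T - - ⟨M, hM, hM'⟩ ⟨N, hN, hN'⟩
    exact ⟨M + N, by rw [Matrix.trace_add, hM, hN, add_zero],
      by rw [map_add, map_add, hM', hN']⟩
  · rintro r T - ⟨M, hM, hM'⟩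
    refine ⟨(r : ℂ) • M, by rw [Matrix.trace_smul, hM, smul_zero], ?_⟩
    rw [map_smul, hM', map_smul]
    exact algebraMap_smul ℂ r (complexify T)
  · rintro S T - - ⟨M, hM, hM'⟩ ⟨N, hN, hN'⟩
    refine ⟨⁅M, N⁆, LieAlgebra.matrix_trace_commutator_zero _ _ _ _, ?_⟩
    rw [LieHom.map_lie, hM', hN', Ring.lie_def, Ring.lie_def, map_sub, map_mul, map_mul]

/-- The complexified Lie algebra acts by the matrices of trace zero. -/
theorem mem_range_actionC_iff (hs : 2 ≤ s) (hG : ∀ a b, G (v a) (v b) = if a = b then 1 else 0)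
    (hω : ∀ j k x y, ω j k x y = ∑ i, (v (i, j) x * v (i, k) y - v (i, j) y * v (i, k) x))
    (T : Module.End ℂ (FormsC V)) :
    T ∈ (actionC (realLieAlgebra G ω v)).range ↔ ∃ M, Matrix.trace M = 0 ∧ glAction v M = T := by
  have hc := isCAR_complex v
  constructor
  · intro hT
    obtain ⟨x, rfl⟩ := (LieHom.mem_range _ _).1 hT
    obtain ⟨S, T, rfl⟩ := exists_tmul_add x
    obtain ⟨M, hM, hM'⟩ := complexify_mem_sl hG hω S S.2
    obtain ⟨N, hN, hN'⟩ := complexify_mem_sl hG hω T T.2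
    refine ⟨M + Complex.I • N, by simp [hM, hN], ?_⟩
    rw [map_add (glAction v), map_add (actionC _), map_smul (glAction v), actionC_tmul,
      actionC_tmul, hM', hN',
      one_smul]
  · rintro ⟨M, hM, rfl⟩
    -- a generator, corrected by a nonzero scalar, is the image of a matrix
    have key (r : ℂ) (hr : r ≠ 0) (N) (T) (hT : T ∈ generators G ω v)
        (h : complexify T = r • glAction v N) :
        N ∈ (actionC (realLieAlgebra G ω v)).range.comap (glAction v) := by
      rw [LieSubalgebra.mem_comap, LieHom.mem_range]
      refine ⟨r⁻¹ ⊗ₜ[ℝ] ⟨T, LieSubalgebra.subset_lieSpan hT⟩, ?_⟩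
      rw [actionC_tmul, h, smul_smul, inv_mul_cancel₀ hr, one_smul]
    refine mem_of_generators (by simpa using hs)
      ((actionC (realLieAlgebra G ω v)).range.comap (glAction v)) ?_ ?_ ?_ ?_ M hM
    · intro j
      refine key (-Complex.I / 2) (by simp) _ _
        ((mem_generators_iff hG hω _).2 (.inr (.inl ⟨j, rfl⟩))) ?_
      rw [glAction_single, ← hc.wedge_mul_wedge_self, map_mul]
      rfl
    · intro j
      refine key (2 * Complex.I) (by simp) _ _
        ((mem_generators_iff hG hω _).2 (.inr (.inr (.inr ⟨j, rfl⟩)))) ?_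
      rw [glAction_single, ← hc.contract_mul_contract_self, map_mul]
      rfl
    · intro j k hjk
      refine key (1 / 2) (by simp) _ _
        ((mem_generators_iff hG hω _).2 (.inl ⟨j, k, hjk, rfl⟩)) ?_
      rw [map_sub, glAction_single, glAction_single, ← hc.wedge_mul_wedge_add, map_add,
        map_mul, map_mul]
      rfl
    · intro j k hjk
      refine key 2 (by simp) _ _
        ((mem_generators_iff hG hω _).2 (.inr (.inr (.inl ⟨j, k, hjk, rfl⟩)))) ?_
      rw [map_sub, glAction_single, glAction_single, ← hc.contract_mul_contract_add,
        map_add, map_mul, map_mul]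
      rfl

end Main

/-! ### Antisymmetrized quadratic expressions -/

section Quadratic

variable {ι B : Type*} [Fintype ι] [Ring B] [Algebra ℂ B]

/-- The sum `∑ M a b ½ [x_a, y_b]`. -/
def quad (x y : ι → B) : Matrix ι ι ℂ →ₗ[ℂ] B where
  toFun M := ∑ a, ∑ b, M a b • (1 / 2 : ℂ) • (x a * y b - y b * x a)
  map_add' M N := by simp [add_smul, Finset.sum_add_distrib]
  map_smul' r M := by simp [Finset.smul_sum, mul_smul]

theorem quad_apply (x y : ι → B) (M : Matrix ι ι ℂ) :
    quad x y M = ∑ a, ∑ b, M a b • (1 / 2 : ℂ) • (x a * y b - y b * x a) := rfl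

theorem quad_single [DecidableEq ι] (x y : ι → B) (a b : ι) :
    quad x y (Matrix.single a b 1) = (1 / 2 : ℂ) • (x a * y b - y b * x a) := by
  rw [quad_apply, Finset.sum_eq_single a, Finset.sum_eq_single b]
  · simp
  · intro c _ hc; simp [hc.symm]
  · simp
  · intro c _ hc; simp [hc.symm]
  · simp

theorem quad_self_of_isSymm (x : ι → B) {P : Matrix ι ι ℂ} (hP : P.IsSymm) : quad x x P = 0 := by
  simp only [quad_apply, smul_sub, Finset.sum_sub_distrib]
  rw [sub_eq_zero]
  conv_rhs => rw [Finset.sum_comm]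
  simp only [hP.apply]

/-- If `[J, x_a] = z x_a` and `[J, y_b] = w y_b` then quadratic expressions have eigenvalue
`z + w`. -/
theorem comm_quad {x y : ι → B} {J : B} {z w : ℂ} (hx : ∀ a, J * x a = x a * J + z • x a)
    (hy : ∀ a, J * y a = y a * J + w • y a) (M : Matrix ι ι ℂ) :
    J * quad x y M = quad x y M * J + (z + w) • quad x y M := by
  have key (a b : ι) : J * (x a * y b - y b * x a) = (x a * y b - y b * x a) * J +
      (z + w) • (x a * y b - y b * x a) := by
    have h1 : J * (x a * y b) = x a * y b * J + (z + w) • (x a * y b) := by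
      rw [← mul_assoc, hx, add_mul, mul_assoc, hy, mul_add, ← mul_assoc, smul_mul_assoc,
        mul_smul_comm, add_smul]
      abel
    have h2 : J * (y b * x a) = y b * x a * J + (z + w) • (y b * x a) := by
      rw [← mul_assoc, hy, add_mul, mul_assoc, hx, mul_add, ← mul_assoc, smul_mul_assoc,
        mul_smul_comm, add_smul]
      abel
    rw [mul_sub, h1, h2, sub_mul, smul_sub]
    abel
  simp only [quad_apply, Finset.mul_sum, Finset.sum_mul, Finset.smul_sum,
    ← Finset.sum_add_distrib, mul_smul_comm, smul_mul_assoc, key]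
  refine Finset.sum_congr rfl fun a _ => Finset.sum_congr rfl fun b _ => ?_
  module

theorem half_comm_mem {B : Type*} [Ring B] [Algebra ℂ B] {s : Set B} (S : Submodule ℂ B)
    (h : ∀ x ∈ s, ∀ y ∈ s, (1 / 2 : ℂ) • (x * y - y * x) ∈ S) {x y : B}
    (hx : x ∈ Submodule.span ℂ s) (hy : y ∈ Submodule.span ℂ s) :
    (1 / 2 : ℂ) • (x * y - y * x) ∈ S := by
  set f : B →ₗ[ℂ] B →ₗ[ℂ] B := (1 / 2 : ℂ) • (LinearMap.mul ℂ B - (LinearMap.mul ℂ B).flip)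
  have h1 := Submodule.apply_mem_map₂ f hx hy
  rw [Submodule.map₂_span_span] at h1
  refine (Submodule.span_le.2 ?_) h1
  rintro _ ⟨x, hx, y, hy, rfl⟩
  exact h x hx y hy

variable [DecidableEq ι]

theorem IsCAR.quad_eq {c d : ι → B} (h : IsCAR c d) (M : Matrix ι ι ℂ) :
    quad c d M = secondQuant ℂ c d M - (M.trace / 2) • (1 : B) := by
  have key (a b : ι) : (1 / 2 : ℂ) • (c a * d b - d b * c a) =
      c a * d b - if b = a then (1 / 2 : ℂ) • (1 : B) else 0 := by
    rw [eq_sub_of_add_eq (h.dc b a)]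
    split_ifs <;> module
  simp only [quad_apply, secondQuant_apply, key, smul_sub, Finset.sum_sub_distrib]
  congr 1
  simp only [Matrix.trace, Finset.sum_div, Finset.sum_smul, smul_ite, smul_zero,
    Finset.sum_ite_eq', Finset.mem_univ, if_true, smul_smul, Matrix.diag_apply]
  simp [div_eq_mul_inv]

/-- Quadratic expressions in the creation operators vanish only if their antisymmetric part does:
the coefficients are recovered by commutators with the annihilation operators. -/
theorem IsCAR.isSymm_of_quad_eq_zero [Nontrivial B] {c d : ι → B} (h : IsCAR c d)
    {P : Matrix ι ι ℂ} (hP : quad c c P = 0) : P.IsSymm := by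
  have h0 : ∑ a, ∑ b, P a b • (c a * c b) = 0 := by
    rw [← hP, quad_apply]
    refine Finset.sum_congr rfl fun a _ => Finset.sum_congr rfl fun b _ => ?_
    rw [eq_neg_of_add_eq_zero_left (h.cc b a)]
    module
  have key (e a b : ι) : d e * (c a * c b) - c a * c b * d e =
      (if e = a then c b else 0) - if e = b then c a else 0 := by
    rw [mul_assoc, eq_sub_of_add_eq' (h.dc e b), ← mul_assoc, eq_sub_of_add_eq (h.dc e a)]
    split_ifs <;> noncomm_ring
  have h1 (e : ι) : ∑ b, (P e b - P b e) • c b = 0 := by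
    have : d e * (∑ a, ∑ b, P a b • (c a * c b)) - (∑ a, ∑ b, P a b • (c a * c b)) * d e = 0 := by
      rw [h0, mul_zero, zero_mul, sub_zero]
    simp only [Finset.mul_sum, Finset.sum_mul, mul_smul_comm, smul_mul_assoc,
      ← Finset.sum_sub_distrib, ← smul_sub, key] at this
    simp only [smul_sub, Finset.sum_sub_distrib, sub_smul] at this ⊢
    rw [Finset.sum_comm] at this
    simpa using this
  refine Matrix.IsSymm.ext fun e f => ?_
  have h2 : d e * (∑ b, (P f b - P b f) • c b) + (∑ b, (P f b - P b f) • c b) * d e = 0 := by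
    rw [h1, mul_zero, zero_mul, zero_add]
  simp only [Finset.mul_sum, Finset.sum_mul, mul_smul_comm, smul_mul_assoc,
    ← Finset.sum_add_distrib, ← smul_add, h.dc] at h2
  simp only [smul_ite, smul_zero, Finset.sum_ite_eq, Finset.mem_univ, if_true] at h2
  exact sub_eq_zero.1 ((smul_eq_zero_iff_left one_ne_zero).1 h2)

end Quadratic

/-! ### Quadratic elements of the Clifford algebra -/

section Clifford

variable {V : Type*} [AddCommGroup V] [Module ℝ V] {s : ℕ}

theorem rhoC_tmul (z : ℂ) (x : Cliff V) : rhoC V (z ⊗ₜ[ℝ] x) = z • complexify (rho V x) := by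
  rw [rhoC, LinearMap.liftBaseChange_tmul]
  rfl

theorem rhoC_mul (x y : ℂ ⊗[ℝ] Cliff V) : rhoC V (x * y) = rhoC V x * rhoC V y := by
  induction x using TensorProduct.induction_on with
  | zero => simp
  | add a b ha hb => rw [add_mul, map_add, map_add, ha, hb, add_mul]
  | tmul z x =>
    induction y using TensorProduct.induction_on with
    | zero => simp
    | add a b ha hb => rw [mul_add, map_add, map_add, ha, hb, mul_add]
    | tmul w y =>
      rw [Algebra.TensorProduct.tmul_mul_tmul, rhoC_tmul, rhoC_tmul, rhoC_tmul, map_mul, map_mul,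
        smul_mul_smul_comm]

theorem rhoC_quad {ι : Type*} [Fintype ι] (x y : ι → ℂ ⊗[ℝ] Cliff V) (M : Matrix ι ι ℂ) :
    rhoC V (quad x y M) = quad (fun a => rhoC V (x a)) (fun a => rhoC V (y a)) M := by
  simp only [quad_apply, map_sum, map_smul, map_sub, rhoC_mul]

/-- The element of the complexified Clifford algebra given by an element of `V^* ⊕ V`. -/
def cliffι (m : Module.Dual ℝ V × V) : ℂ ⊗[ℝ] Cliff V :=
  (1 : ℂ) ⊗ₜ[ℝ] CliffordAlgebra.ι (QuadraticForm.dualProd ℝ V) m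

theorem rhoC_cliffι_wedge (v : Coframe s V) (p : Fin 2 × Fin (s + 1)) :
    rhoC V (cliffι (v p, 0)) = wedgeC v p := by
  rw [cliffι, rhoC_tmul, one_smul, wedgeC, rho, CliffordAlgebra.lift_ι_apply]
  congr 1
  refine LinearMap.ext fun x => ?_
  simp [opE, wedge]

theorem baseChange_quadraticPart :
    (quadraticPart V).baseChange ℂ = Submodule.span ℂ
      {x | ∃ m m' : Module.Dual ℝ V × V,
        x = (1 / 2 : ℂ) • (cliffι m * cliffι m' - cliffι m' * cliffι m)} := by
  rw [quadraticPart, Submodule.baseChange_span]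
  congr 1
  ext x
  have h (m m' : Module.Dual ℝ V × V) : TensorProduct.mk ℝ ℂ (Cliff V) 1 ((1 / 2 : ℝ) •
      (CliffordAlgebra.ι (QuadraticForm.dualProd ℝ V) m *
        CliffordAlgebra.ι (QuadraticForm.dualProd ℝ V) m' -
      CliffordAlgebra.ι (QuadraticForm.dualProd ℝ V) m' *
        CliffordAlgebra.ι (QuadraticForm.dualProd ℝ V) m)) =
      (1 / 2 : ℂ) • (cliffι m * cliffι m' - cliffι m' * cliffι m) := by
    simp only [cliffι, Algebra.TensorProduct.tmul_mul_tmul, mul_one, ← TensorProduct.tmul_sub,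
      TensorProduct.mk_apply, TensorProduct.tmul_smul]
    refine (algebraMap_smul ℂ (1 / 2 : ℝ) _).symm.trans ?_
    congr 1
    simp
  constructor
  · rintro ⟨_, ⟨m, m', rfl⟩, rfl⟩
    exact ⟨m, m', h m m'⟩
  · rintro ⟨m, m', rfl⟩
    exact ⟨_, ⟨m, m', rfl⟩, h m m'⟩

theorem mem_quadraticInvariants (v : Coframe s V) (x : ℂ ⊗[ℝ] Cliff V) :
    x ∈ quadraticInvariants v ↔
      x ∈ (quadraticPart V).baseChange ℂ ∧ opJC v * rhoC V x = rhoC V x * opJC v := by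
  rw [quadraticInvariants, Submodule.mem_inf]
  refine and_congr_right fun _ => ?_
  rw [Submodule.mem_comap, Subalgebra.mem_toSubmodule, Subalgebra.mem_centralizer_iff]
  simp

variable [FiniteDimensional ℝ V]

/-- The frame of `V` dual to a coframe. -/
def dualFrame (v : Coframe s V) (p : Fin 2 × Fin (s + 1)) : V :=
  (Module.evalEquiv ℝ V).symm (v.coord p)

theorem rhoC_cliffι_contract (v : Coframe s V) (p : Fin 2 × Fin (s + 1)) :
    rhoC V (cliffι (0, dualFrame v p)) = contractC v p := by
  rw [cliffι, rhoC_tmul, one_smul, contractC, rho, CliffordAlgebra.lift_ι_apply]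
  congr 1
  have h : Module.Dual.eval ℝ V (dualFrame v p) = v.coord p := by
    rw [← Module.evalEquiv_toLinearMap]
    exact (Module.evalEquiv ℝ V).apply_symm_apply _
  refine LinearMap.ext fun x => ?_
  simp [opI, interior, h]

/-- The elements of weight one in the complexification of `V^* ⊕ V`. -/
def cliffUp (v : Coframe s V) : Fin (s + 1) ⊕ Fin (s + 1) → ℂ ⊗[ℝ] Cliff V :=
  raising (fun p => cliffι (v p, 0)) (fun p => cliffι (0, dualFrame v p))

/-- The elements of weight minus one in the complexification of `V^* ⊕ V`. -/
def cliffDown (v : Coframe s V) : Fin (s + 1) ⊕ Fin (s + 1) → ℂ ⊗[ℝ] Cliff V :=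
  lowering (fun p => cliffι (v p, 0)) (fun p => cliffι (0, dualFrame v p))

theorem rhoC_cliffUp (v : Coframe s V) (a : Fin (s + 1) ⊕ Fin (s + 1)) :
    rhoC V (cliffUp v a) = up v a := by
  rw [cliffUp, map_raising]
  simp only [rhoC_cliffι_wedge, rhoC_cliffι_contract]

theorem rhoC_cliffDown (v : Coframe s V) (a : Fin (s + 1) ⊕ Fin (s + 1)) :
    rhoC V (cliffDown v a) = down v a := by
  rw [cliffDown, map_lowering]
  simp only [rhoC_cliffι_wedge, rhoC_cliffι_contract]

/-- The elements of weight one and minus one span the complexification of `V^* ⊕ V`. -/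
theorem cliffι_mem_span (v : Coframe s V) (m : Module.Dual ℝ V × V) :
    cliffι m ∈ Submodule.span ℂ (Set.range (cliffUp v) ∪ Set.range (cliffDown v)) := by
  set S := Submodule.span ℂ (Set.range (cliffUp v) ∪ Set.range (cliffDown v))
  have hU (a) : cliffUp v a ∈ S := Submodule.subset_span (.inl ⟨a, rfl⟩)
  have hD (a) : cliffDown v a ∈ S := Submodule.subset_span (.inr ⟨a, rfl⟩)
  set e : Fin 2 × Fin (s + 1) → ℂ ⊗[ℝ] Cliff V := fun p => cliffι (v p, 0)
  set i : Fin 2 × Fin (s + 1) → ℂ ⊗[ℝ] Cliff V := fun p => cliffι (0, dualFrame v p)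
  have he (p) : e p ∈ S := by
    obtain ⟨a, j⟩ := p
    fin_cases a
    · change e (0, j) ∈ S
      rw [eq_raising_lowering_wedge_zero e i j]
      exact S.smul_mem _ (S.add_mem (hU _) (hD _))
    · change e (1, j) ∈ S
      rw [eq_raising_lowering_wedge_one e i j]
      exact S.smul_mem _ (S.sub_mem (hU _) (hD _))
  have hi (p) : i p ∈ S := by
    obtain ⟨a, j⟩ := p
    fin_cases a
    · change i (0, j) ∈ S
      rw [eq_raising_lowering_contract_zero e i j]
      exact S.add_mem (hD _) (hU _)
    · change i (1, j) ∈ S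
      rw [eq_raising_lowering_contract_one e i j]
      exact S.smul_mem _ (S.sub_mem (hU _) (hD _))
  obtain ⟨a, x⟩ := m
  have hx : x = ∑ p, v p x • dualFrame v p := by
    apply (Module.evalEquiv ℝ V).injective
    rw [map_sum]
    simp only [map_smul, dualFrame, LinearEquiv.apply_symm_apply]
    exact (v.sum_dual_apply_smul_coord (Module.evalEquiv ℝ V x)).symm
  have hr (r : ℝ) (y : ℂ ⊗[ℝ] Cliff V) : (r : ℂ) • y = r • y := algebraMap_smul ℂ r y
  have h : cliffι (a, x) = ∑ p, ((v.coord p a : ℝ) : ℂ) • e p + ∑ p, ((v p x : ℝ) : ℂ) • i p := by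
    have h1 : (a, x) = ∑ p, v.coord p a • ((v p, 0) : Module.Dual ℝ V × V) +
        ∑ p, v p x • ((0, dualFrame v p) : Module.Dual ℝ V × V) := by
      refine Prod.ext ?_ ?_
      · simp [Prod.fst_sum, v.sum_repr]
      · simpa [Prod.snd_sum] using hx
    rw [h1]
    simp only [cliffι, map_add, map_sum, map_smul, TensorProduct.tmul_add, TensorProduct.tmul_sum,
      TensorProduct.tmul_smul, e, i, hr]
  rw [h]
  exact S.add_mem (S.sum_mem fun p _ => S.smul_mem _ (he p))
    (S.sum_mem fun p _ => S.smul_mem _ (hi p))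

/-- Every complex quadratic element is a sum of quadratic elements of weights `2`, `-2` and `0`. -/
theorem exists_quad_of_mem (v : Coframe s V) {x : ℂ ⊗[ℝ] Cliff V}
    (hx : x ∈ (quadraticPart V).baseChange ℂ) : ∃ P Q M, x = quad (cliffUp v) (cliffUp v) P +
      quad (cliffDown v) (cliffDown v) Q + quad (cliffUp v) (cliffDown v) M := by
  set S := LinearMap.range (quad (cliffUp v) (cliffUp v)) ⊔
    LinearMap.range (quad (cliffDown v) (cliffDown v)) ⊔
    LinearMap.range (quad (cliffUp v) (cliffDown v))
  suffices H : x ∈ S by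
    obtain ⟨_, h, _, ⟨M, rfl⟩, rfl⟩ := Submodule.mem_sup.1 H
    obtain ⟨_, ⟨P, rfl⟩, _, ⟨Q, rfl⟩, rfl⟩ := Submodule.mem_sup.1 h
    exact ⟨P, Q, M, rfl⟩
  rw [baseChange_quadraticPart] at hx
  refine Submodule.span_le.2 ?_ hx
  rintro _ ⟨m, m', rfl⟩
  refine half_comm_mem S ?_ (cliffι_mem_span v m) (cliffι_mem_span v m')
  have hUD (a b) : (1 / 2 : ℂ) • (cliffUp v a * cliffDown v b - cliffDown v b * cliffUp v a) ∈ S :=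
    Submodule.mem_sup_right ⟨Matrix.single a b 1, quad_single _ _ a b⟩
  rintro _ (⟨a, rfl⟩ | ⟨a, rfl⟩) _ (⟨b, rfl⟩ | ⟨b, rfl⟩)
  · exact Submodule.mem_sup_left (Submodule.mem_sup_left
      ⟨Matrix.single a b 1, quad_single _ _ a b⟩)
  · exact hUD a b
  · rw [← neg_sub, smul_neg]
    exact S.neg_mem (hUD b a)
  · exact Submodule.mem_sup_left (Submodule.mem_sup_right
      ⟨Matrix.single a b 1, quad_single _ _ a b⟩)

theorem quad_mem (v : Coframe s V)
    (M : Matrix (Fin (s + 1) ⊕ Fin (s + 1)) (Fin (s + 1) ⊕ Fin (s + 1)) ℂ) :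
    quad (cliffUp v) (cliffDown v) M ∈ (quadraticPart V).baseChange ℂ := by
  rw [quad_apply]
  refine Submodule.sum_mem _ fun a _ => Submodule.sum_mem _ fun b _ => Submodule.smul_mem _ _ ?_
  have hs (m : Module.Dual ℝ V × V) : cliffι m ∈
      Submodule.span ℂ (Set.range (cliffι (V := V))) := Submodule.subset_span ⟨m, rfl⟩
  refine half_comm_mem (s := Set.range cliffι) _ ?_ ?_ ?_
  · rintro _ ⟨m, rfl⟩ _ ⟨m', rfl⟩
    rw [baseChange_quadraticPart]
    exact Submodule.subset_span ⟨m, m', rfl⟩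
  · rcases a with j | j
    · exact Submodule.sub_mem _ (hs _) (Submodule.smul_mem _ _ (hs _))
    · exact Submodule.smul_mem _ _ (Submodule.sub_mem _ (hs _) (Submodule.smul_mem _ _ (hs _)))
  · rcases b with j | j
    · exact Submodule.smul_mem _ _ (Submodule.add_mem _ (hs _) (Submodule.smul_mem _ _ (hs _)))
    · exact Submodule.add_mem _ (hs _) (Submodule.smul_mem _ _ (hs _))

theorem rhoC_quad_cliff (v : Coframe s V)
    (M : Matrix (Fin (s + 1) ⊕ Fin (s + 1)) (Fin (s + 1) ⊕ Fin (s + 1)) ℂ) :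
    rhoC V (quad (cliffUp v) (cliffDown v) M) = glAction v M - (M.trace / 2) • 1 := by
  rw [rhoC_quad]
  simp only [rhoC_cliffUp, rhoC_cliffDown]
  exact (isCAR_up_down v).quad_eq M

/-- The quadratic invariants are the quadratic elements of weight zero. -/
theorem mem_quadraticInvariants_iff (v : Coframe s V) (x : ℂ ⊗[ℝ] Cliff V) :
    x ∈ quadraticInvariants v ↔ ∃ M, x = quad (cliffUp v) (cliffDown v) M := by
  rw [mem_quadraticInvariants]
  constructor
  · rintro ⟨hx, hJ⟩
    obtain ⟨P, Q, M, rfl⟩ := exists_quad_of_mem v hx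
    have hU (a) : opJC v * up v a = up v a * opJC v + Complex.I • up v a := opJC_mul_up v a
    have hD (a) : opJC v * down v a = down v a * opJC v + (-Complex.I) • down v a := by
      rw [opJC_mul_down]; module
    have hP := comm_quad hU hU P
    have hQ := comm_quad hD hD Q
    have hM := comm_quad hU hD M
    rw [add_neg_cancel, zero_smul, add_zero] at hM
    rw [map_add, map_add, rhoC_quad, rhoC_quad, rhoC_quad] at hJ
    simp only [rhoC_cliffUp, rhoC_cliffDown] at hJ
    set p := quad (up v) (up v) P
    set q := quad (down v) (down v) Q
    simp only [mul_add, add_mul, hP, hQ, hM] at hJ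
    -- the components of weights `2` and `-2` of the commutator with `J` must cancel
    have h1 : (2 * Complex.I) • (p - q) = 0 := by
      rw [← sub_eq_zero] at hJ
      rw [← hJ]; module
    have h2 : p = q := sub_eq_zero.1 ((smul_eq_zero_iff_right (by simp)).1 h1)
    rw [← h2, hP] at hQ
    have h3 : (4 * Complex.I) • p = 0 := by
      have := add_left_cancel hQ
      rw [← sub_eq_zero] at this
      rw [← this]; module
    have h4 : p = 0 := (smul_eq_zero_iff_right (by simp)).1 h3
    have h5 : P.IsSymm := (isCAR_up_down v).isSymm_of_quad_eq_zero h4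
    have h6 : Q.IsSymm := (isCAR_up_down v).symm.isSymm_of_quad_eq_zero (h2.symm.trans h4)
    exact ⟨M, by rw [quad_self_of_isSymm _ h5, quad_self_of_isSymm _ h6, zero_add, zero_add]⟩
  · rintro ⟨M, rfl⟩
    refine ⟨quad_mem v M, ?_⟩
    rw [rhoC_quad_cliff, mul_sub, sub_mul, glAction_comm_opJC, mul_smul_comm, smul_mul_assoc,
      one_mul, mul_one]

end Clifford

/-! ### The complexified Lie algebra of an adapted coframe -/

section Conclusion

variable {V : Type*} [AddCommGroup V] [Module ℝ V] {s : ℕ}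

theorem trace_one_half :
    (1 : Matrix (Fin (s + 1) ⊕ Fin (s + 1)) (Fin (s + 1) ⊕ Fin (s + 1)) ℂ).trace / 2 = s + 1 := by
  rw [Matrix.trace_one]
  simp

/-- The lowest weight vector is killed by all the matrices, so that a nonzero scalar operator is
never the action of a matrix. -/
theorem eq_zero_of_glAction_eq_smul_one (v : Coframe s V)
    {M : Matrix (Fin (s + 1) ⊕ Fin (s + 1)) (Fin (s + 1) ⊕ Fin (s + 1)) ℂ} {r : ℂ}
    (h : glAction v M = r • 1) : r = 0 := by
  obtain ⟨Ω, hΩ⟩ := exists_isVacuum v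
  have h1 : r • Ω = glAction v M Ω := by rw [h]; rfl
  rw [glAction_apply, secondQuant_apply] at h1
  simp only [LinearMap.sum_apply, LinearMap.smul_apply, Module.End.mul_apply, hΩ.annihilate,
    map_zero, smul_zero, Finset.sum_const_zero] at h1
  exact (smul_eq_zero_iff_left hΩ.ne_zero).1 h1

variable [FiniteDimensional ℝ V] {G : LinearMap.BilinForm ℝ (Module.Dual ℝ V)}
  {v : Coframe s V} {ω : Fin (s + 1) → Fin (s + 1) → V →ₗ[ℝ] V →ₗ[ℝ] ℝ}

theorem nonempty_lieEquiv_sl (hs : 2 ≤ s) (hG : ∀ a b, G (v a) (v b) = if a = b then 1 else 0)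
    (hω : ∀ j k x y, ω j k x y = ∑ i, (v (i, j) x * v (i, k) y - v (i, j) y * v (i, k) x)) :
    Nonempty (ℂ ⊗[ℝ] realLieAlgebra G ω v ≃ₗ⁅ℂ⁆
      LieAlgebra.SpecialLinear.sl (Fin (2 * s + 2)) ℂ) := by
  let e : Fin (2 * s + 2) ≃ Fin (s + 1) ⊕ Fin (s + 1) :=
    (finCongr (by ring)).trans finSumFinEquiv.symm
  let f : LieAlgebra.SpecialLinear.sl (Fin (2 * s + 2)) ℂ →ₗ⁅ℂ⁆ Module.End ℂ (FormsC V) :=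
    (glAction v).comp ((Matrix.reindexLieEquiv (R := ℂ) e).toLieHom.comp
      (LieAlgebra.SpecialLinear.sl (Fin (2 * s + 2)) ℂ).incl)
  have hf (M : LieAlgebra.SpecialLinear.sl (Fin (2 * s + 2)) ℂ) :
      f M = glAction v (Matrix.reindex e e M.1) := rfl
  have hinj : Function.Injective f := fun M N h => by
    rw [hf, hf] at h
    exact Subtype.ext ((Matrix.reindex e e).injective (glAction_injective v h))
  have hrange : ((actionC (realLieAlgebra G ω v)).range : Set (Module.End ℂ (FormsC V))) =
      f.range := by
    ext T
    rw [SetLike.mem_coe, SetLike.mem_coe, mem_range_actionC_iff hs hG hω, LieHom.mem_range]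
    constructor
    · rintro ⟨M, hM, rfl⟩
      refine ⟨⟨Matrix.reindex e.symm e.symm M, ?_⟩, ?_⟩
      · change (Matrix.reindex e.symm e.symm M).trace = 0
        rw [← hM]
        exact e.sum_comp fun i => M i i
      · rw [hf]
        congr 1
        ext i j
        simp
    · rintro ⟨M, rfl⟩
      refine ⟨_, ?_, (hf M).symm⟩
      have hM : Matrix.trace M.1 = 0 := M.2
      rw [← hM]
      exact e.symm.sum_comp fun i => M.1 i i
  exact ⟨(LieEquiv.ofInjective _ (actionC_injective _)).trans
    ((LieEquiv.ofEq _ _ hrange).trans (LieEquiv.ofInjective f hinj).symm)⟩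

theorem disjoint_range_span_opJC (hs : 2 ≤ s)
    (hG : ∀ a b, G (v a) (v b) = if a = b then 1 else 0)
    (hω : ∀ j k x y, ω j k x y = ∑ i, (v (i, j) x * v (i, k) y - v (i, j) y * v (i, k) x)) :
    Disjoint (LinearMap.range (actionC (realLieAlgebra G ω v) :
        ℂ ⊗[ℝ] realLieAlgebra G ω v →ₗ[ℂ] Module.End ℂ (FormsC V)))
      (Submodule.span ℂ {opJC v}) := by
  rw [Submodule.disjoint_def]
  intro T hT hJ
  obtain ⟨M, hM, rfl⟩ := (mem_range_actionC_iff hs hG hω T).1 hT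
  obtain ⟨z, hz⟩ := Submodule.mem_span_singleton.1 hJ
  rw [opJC_eq] at hz
  have h : glAction v ((z * Complex.I) • 1 - M) = (z * Complex.I * ((s + 1 : ℕ) : ℂ)) • 1 := by
    rw [map_sub, map_smul, ← hz]
    module
  have h1 := eq_zero_of_glAction_eq_smul_one v h
  have h2 : z = 0 := by
    have : ((s + 1 : ℕ) : ℂ) ≠ 0 := by exact_mod_cast s.succ_ne_zero
    simpa [Complex.I_ne_zero, this, -Nat.cast_add] using h1
  rw [← hz, h2, zero_smul]

theorem bijOn_rhoC (hs : 2 ≤ s)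
    (hG : ∀ a b, G (v a) (v b) = if a = b then 1 else 0)
    (hω : ∀ j k x y, ω j k x y = ∑ i, (v (i, j) x * v (i, k) y - v (i, j) y * v (i, k) x)) :
    Set.BijOn (rhoC V) (quadraticInvariants v)
      (LinearMap.range (actionC (realLieAlgebra G ω v) :
        ℂ ⊗[ℝ] realLieAlgebra G ω v →ₗ[ℂ] Module.End ℂ (FormsC V)) ⊔
        Submodule.span ℂ {opJC v} : Submodule ℂ _) := by
  have hn : ((s : ℂ) + 1) ≠ 0 := by exact_mod_cast s.succ_ne_zero
  refine ⟨?_, ?_, ?_⟩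
  · intro x hx
    obtain ⟨M, rfl⟩ := (mem_quadraticInvariants_iff v x).1 hx
    rw [rhoC_quad_cliff]
    -- split `M` into a matrix of trace zero and a scalar matrix
    set t : ℂ := M.trace / 2 / (s + 1)
    have ht : M.trace / 2 = t * (s + 1) := (div_mul_cancel₀ _ hn).symm
    refine Submodule.mem_sup.2 ⟨glAction v (M - t • 1), ?_, (-Complex.I * t) • opJC v,
      Submodule.smul_mem _ _ (Submodule.mem_span_singleton_self _), ?_⟩
    · refine (mem_range_actionC_iff hs hG hω _).2 ⟨_, ?_, rfl⟩
      have h1 := trace_one_half (s := s)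
      rw [Matrix.trace_sub, Matrix.trace_smul, smul_eq_mul]
      linear_combination 2 * ht - 2 * t * h1
    · rw [opJC_eq, map_sub, map_smul, ht, smul_smul]
      have hI : -Complex.I * t * Complex.I = t := by linear_combination -t * Complex.I_mul_I
      rw [hI]
      push_cast
      module
  · intro x hx y hy h
    obtain ⟨M, rfl⟩ := (mem_quadraticInvariants_iff v x).1 hx
    obtain ⟨N, rfl⟩ := (mem_quadraticInvariants_iff v y).1 hy
    rw [← sub_eq_zero, ← map_sub, ← map_sub, rhoC_quad_cliff, sub_eq_zero] at h
    rw [eq_zero_of_glAction_eq_smul_one v h, zero_smul, ← map_zero (glAction v)] at h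
    rw [sub_eq_zero.1 (glAction_injective v h)]
  · intro T hT
    obtain ⟨_, h1, _, h2, rfl⟩ := Submodule.mem_sup.1 hT
    obtain ⟨M, hM, rfl⟩ := (mem_range_actionC_iff hs hG hω _).1 h1
    obtain ⟨z, rfl⟩ := Submodule.mem_span_singleton.1 h2
    refine ⟨_, (mem_quadraticInvariants_iff v _).2 ⟨M + (z * Complex.I) • 1, rfl⟩, ?_⟩
    rw [rhoC_quad_cliff, opJC_eq, map_add, map_smul, Matrix.trace_add, hM, Matrix.trace_smul,
      zero_add, smul_eq_mul, mul_div_assoc, trace_one_half]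
    push_cast
    module

theorem actionC_mem_weightSpace (hs : 2 ≤ s)
    (hG : ∀ a b, G (v a) (v b) = if a = b then 1 else 0)
    (hω : ∀ j k x y, ω j k x y = ∑ i, (v (i, j) x * v (i, k) y - v (i, j) y * v (i, k) x))
    (α : ℤ) (x : ℂ ⊗[ℝ] realLieAlgebra G ω v) (φ : FormsC V) (hφ : φ ∈ weightSpace v α) :
    actionC _ x φ ∈ weightSpace v α := by
  obtain ⟨M, -, hM⟩ := (mem_range_actionC_iff hs hG hω _).1 (LieHom.mem_range_self _ x)
  rw [← hM]
  rw [weightSpace, Module.End.mem_eigenspace_iff] at hφ ⊢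
  have := congrArg (· φ) (glAction_comm_opJC v M)
  simp only [Module.End.mul_apply, hφ] at this
  rw [this, map_smul]

theorem eq_zero_of_actionC (hs : 2 ≤ s)
    (hG : ∀ a b, G (v a) (v b) = if a = b then 1 else 0)
    (hω : ∀ j k x y, ω j k x y = ∑ i, (v (i, j) x * v (i, k) y - v (i, j) y * v (i, k) x))
    (x : ℂ ⊗[ℝ] realLieAlgebra G ω v)
    (h : ∀ φ ∈ weightSpace v (-(s : ℤ)), actionC _ x φ = 0) : x = 0 := by
  obtain ⟨M, -, hM⟩ := (mem_range_actionC_iff hs hG hω _).1 (LieHom.mem_range_self _ x)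
  rw [← hM] at h
  rw [eq_zero_of_glAction v M h, map_zero] at hM
  exact actionC_injective _ (hM.symm.trans (map_zero _).symm)

end Conclusion
end SKahler
end

theorem mainTheorem2 {s : ℕ} (hs : 2 ≤ s) {M : Type*} [TopologicalSpace M]
    [ChartedSpace (SKahler.Model s) M] [IsManifold 𝓘(ℝ, SKahler.Model s) (⊤ : ℕ∞) M]
    (X : SKahler.PointwiseSKahler s M) (p : M)
    (v : SKahler.Coframe s (SKahler.Tangent s p)) (hv : X.IsAdaptedCoframe p v) :
    -- (a)
    Nonempty (X.FibreC p v ≃ₗ⁅ℂ⁆ LieAlgebra.SpecialLinear.sl (Fin (2 * s + 2)) ℂ) ∧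
    -- (b)
    (Disjoint (LinearMap.range (X.action p v : X.FibreC p v →ₗ[ℂ] _))
        (Submodule.span ℂ {SKahler.opJC v}) ∧
      Set.BijOn (SKahler.rhoC (SKahler.Tangent s p)) (SKahler.quadraticInvariants v)
        (LinearMap.range (X.action p v : X.FibreC p v →ₗ[ℂ] _) ⊔
          Submodule.span ℂ {SKahler.opJC v} : Submodule ℂ _)) ∧
    -- (c)
    (Module.finrank ℂ (SKahler.weightSpace v (-(s : ℤ))) = 2 * s + 2 ∧
      (∀ x, ∀ φ ∈ SKahler.weightSpace v (-(s : ℤ)),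
        X.action p v x φ ∈ SKahler.weightSpace v (-(s : ℤ))) ∧
      ∀ x, (∀ φ ∈ SKahler.weightSpace v (-(s : ℤ)), X.action p v x φ = 0) → x = 0) := by
  have hω (j k : Fin (s + 1)) (x y : SKahler.Tangent s p) :
      SKahler.toBilin (X.ω j k p) x y =
        ∑ i, (v (i, j) x * v (i, k) y - v (i, j) y * v (i, k) x) := hv.2 j k x y
  exact ⟨SKahler.nonempty_lieEquiv_sl hs hv.1 hω,
    ⟨SKahler.disjoint_range_span_opJC hs hv.1 hω, SKahler.bijOn_rhoC hs hv.1 hω⟩,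
    SKahler.finrank_weightSpace v, SKahler.actionC_mem_weightSpace hs hv.1 hω _,
    SKahler.eq_zero_of_actionC hs hv.1 hω⟩
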